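/- **Setting.** For $x\in\mathbb R^{n+1}\setminus\{0\}$ let $[x]\in\mathbb{RP}^n$ be the corresponding point; $\vee$ denotes the join of projective subspaces. A quadric in a projective space is the zero set $\{[x] : \varphi(x,x)=0\}$ of a non-zero symmetric bilinear form $\varphi$ on the underlying vector space; a conic is a quadric in a plane. A conic touches a line $L$ at a point $X\in L$ if $L$ is contained in the polar $X^\perp$ of $X$. Let $a,b\ge 1$ and $\Sigma_{a,b}=\{0,\dots,a\}\times\{0,\dots,b\}$. A Q-net is a map $P:\Sigma_{a,b}\to\mathbb{RP}^n$ such that the image of each face $\{i,i+1\}\times\{j,j+1\}$ lies in a plane. It is non-degenerate if the two points of every edge are distinct and any three points of every face span a plane; it is extensive if, moreover, its points join an $(a+b)$-dimensional projective space. An inscribed conic of a face of a non-degenerate Q-net is a conic in the plane $\Pi(i,j)=P(i,j)\vee P(i+1,j)\vee P(i,j+1)$ of the face that touches the four edge lines, where a double line is admitted only if it is the line through the two intersection points of opposite edge lines (the Laplace points). An instance $\mathcal C$ of touching conics of $P$ equips each face $(i,j)$, $0\le i<a$, $0\le j<b$, with an inscribed conic $\mathcal C(i,j)$ such that for every edge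 shared by two faces the two conics touch the line of the edge at the same point. The touching points are denoted by $S(i,j)\in P(i,j)\vee P(i+1,j)$ ($0\le i<a$, $0\le j\le b$) and $T(i,j)\in P(i,j)\vee P(i,j+1)$ ($0\le i\le a$, $0\le j<b$). A non-degenerate Q-net is a Kœnigs net if it admits an instance of touching conics. **Theorem.** Let $P:\Sigma_{a,b}\to\mathbb{RP}^{a+b}$ be an extensive Kœnigs net. 1. For every instance $\mathcal C$ of touching conics of $P$, with touching points $S,T$, there is exactly one quadric $\mathcal Q\subset\mathbb{RP}^{a+b}$ (as a set of points) that is an *inscribed quadric* for $\mathcal C$, which means that - $\mathcal C(i,j)=\mathcal Q\cap\Pi(i,j)$ for all $0\le i<a$, $0\le j<b$; - for every $0\le i\le a$ the join of the points $T(i,0),\dots,T(i,b-1)$ is contained in $\mathcal Q$; - for every $0\le j\le b$ the join of the points $S(0,j),\dots,S(a-1,j)$ is contained in $\mathcal Q$. 2. The instances of touching conics of $P$, and with them the inscribed quadrics of $P$, form a 1-parameter family: there are a bijection $t\mapsto\mathcal C_t$ from $\mathbb R\setminus\{0\}$ onto the set of all instances of touching conics of $P$, and non-zero symmetric bilinear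 forms $\varphi_t$ on $\mathbb R^{a+b+1}$ depending continuously on $t\in\mathbb R\setminus\{0\}$, such that $\mathcal Q_t=\{[x] : \varphi_t(x,x)=0\}$ is the inscribed quadric for $\mathcal C_t$, and $t\mapsto\mathcal Q_t$ is a bijection from $\mathbb R\setminus\{0\}$ onto the set of all quadrics that are inscribed quadrics of $P$ for some instance of touching conics. -/

import Mathlib

open scoped LinearAlgebra.Projectivization

namespace KoenigsNet

/-- Real projective space of dimension `n`, the set of lines through `0` in `ℝⁿ⁺¹`. -/
abbrev RP (n : ℕ) : Type := ℙ ℝ (Fin (n + 1) → ℝ)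

/-- Linear subspaces of `ℝⁿ⁺¹`.  The subspace `W` stands for the projective subspace `[W]` of
`RP n`, whose projective dimension is `finrank W - 1`; the join of projective subspaces is the
supremum `⊔` of the linear ones. -/
abbrev Sub (n : ℕ) : Type := Submodule ℝ (Fin (n + 1) → ℝ)

/-- Bilinear forms on `ℝⁿ⁺¹`. -/
abbrev Form (n : ℕ) : Type := LinearMap.BilinForm ℝ (Fin (n + 1) → ℝ)

/-- The set of points of the projective subspace `[W]`. -/
def points {n : ℕ} (W : Sub n) : Set (RP n) := {X | X.submodule ≤ W}

/-- The join of two points (their line, if they are distinct). -/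
noncomputable def join₂ {n : ℕ} (X Y : RP n) : Sub n := X.submodule ⊔ Y.submodule

/-- The join of three points (their plane, if they are not collinear). -/
noncomputable def join₃ {n : ℕ} (X Y Z : RP n) : Sub n := X.submodule ⊔ Y.submodule ⊔ Z.submodule

/-- The zero set `{[x] | φ(x, x) = 0}` of a bilinear form. -/
def zeroSet {n : ℕ} (φ : Form n) : Set (RP n) := {X | φ X.rep X.rep = 0}

/-- A quadric in `RP n`: the zero set of a non-trivial symmetric bilinear form. -/
def IsQuadric {n : ℕ} (Q : Set (RP n)) : Prop :=
  ∃ φ : Form n, φ.IsSymm ∧ φ ≠ 0 ∧ Q = zeroSet φ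

/-- `C` is the quadric of the projective space `[W]` given by the (non-trivial, symmetric)
restriction of `φ` to `W`.  Every symmetric form on `W` is the restriction of a symmetric form on
the whole space.  If `[W]` is a plane, then `C` is a conic in that plane. -/
def Defines {n : ℕ} (φ : Form n) (W : Sub n) (C : Set (RP n)) : Prop :=
  φ.IsSymm ∧ (∃ x ∈ W, ∃ y ∈ W, φ x y ≠ 0) ∧ C = zeroSet φ ∩ points W

/-- The conic `C` of the plane `[W]` touches the line `[L]` at the point `X`: the point `X` lies on
`[L]`, and `[L]` is contained in the polar of `X`.  (In particular, `X` lies on `C`.) -/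
def TouchesAt {n : ℕ} (W : Sub n) (C : Set (RP n)) (L : Sub n) (X : RP n) : Prop :=
  ∃ φ : Form n, Defines φ W C ∧ X ∈ points L ∧ ∀ y ∈ L, φ X.rep y = 0

/-- `C` is an inscribed conic of the planar quad with the vertices `A, B, B', A'` in cyclic order
(so that its edges are `AB`, `BB'`, `B'A'`, `A'A`): a conic in the plane of the quad that touches
the four edge lines, where a double line is admitted only if it is the line through the two
Laplace points `AB ∩ A'B'` and `AA' ∩ BB'` of the quad. -/
structure IsInscribedConic {n : ℕ} (A B A' B' : RP n) (C : Set (RP n)) : Prop where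
  isConic : ∃ φ : Form n, Defines φ (join₃ A B A') C
  touches₁ : ∃ X, TouchesAt (join₃ A B A') C (join₂ A B) X
  touches₂ : ∃ X, TouchesAt (join₃ A B A') C (join₂ A' B') X
  touches₃ : ∃ X, TouchesAt (join₃ A B A') C (join₂ A A') X
  touches₄ : ∃ X, TouchesAt (join₃ A B A') C (join₂ B B') X
  doubleLine : ∀ M : Sub n, Module.finrank ℝ M = 2 → C = points M →
    join₂ A B ⊓ join₂ A' B' ≤ M ∧ join₂ A A' ⊓ join₂ B B' ≤ M

/-- A net on `Σ_{a,b} = {0, …, a} × {0, …, b}` in `RP n`. -/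
abbrev Net (a b n : ℕ) : Type := Fin (a + 1) → Fin (b + 1) → RP n

section nets

variable {a b n : ℕ} (P : Net a b n)

/-- A Q-net: the image of each face is contained in a plane. -/
def IsQNet : Prop :=
  ∀ (i : Fin a) (j : Fin b), ∃ W : Sub n, Module.finrank ℝ W = 3 ∧
    P i.castSucc j.castSucc ∈ points W ∧ P i.succ j.castSucc ∈ points W ∧
    P i.castSucc j.succ ∈ points W ∧ P i.succ j.succ ∈ points W

/-- Non-degeneracy: adjacent vertices have distinct images, and any three vertices of a face span a
plane. -/
structure IsNondegenerate : Prop where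
  horizontal : ∀ (i : Fin a) (j : Fin (b + 1)), P i.castSucc j ≠ P i.succ j
  vertical : ∀ (i : Fin (a + 1)) (j : Fin b), P i j.castSucc ≠ P i j.succ
  triple₁ : ∀ (i : Fin a) (j : Fin b), Module.finrank ℝ
    (join₃ (P i.castSucc j.castSucc) (P i.succ j.castSucc) (P i.castSucc j.succ)) = 3
  triple₂ : ∀ (i : Fin a) (j : Fin b), Module.finrank ℝ
    (join₃ (P i.castSucc j.castSucc) (P i.succ j.castSucc) (P i.succ j.succ)) = 3
  triple₃ : ∀ (i : Fin a) (j : Fin b), Module.finrank ℝ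
    (join₃ (P i.castSucc j.castSucc) (P i.castSucc j.succ) (P i.succ j.succ)) = 3
  triple₄ : ∀ (i : Fin a) (j : Fin b), Module.finrank ℝ
    (join₃ (P i.succ j.castSucc) (P i.castSucc j.succ) (P i.succ j.succ)) = 3

/-- An extensive Q-net on `Σ_{a,b}`: it is non-degenerate, and its points join an
`(a + b)`-dimensional projective space. -/
structure IsExtensive : Prop where
  isQNet : IsQNet P
  isNondegenerate : IsNondegenerate P
  finrank_join : Module.finrank ℝ (⨆ i, ⨆ j, (P i j).submodule : Sub n) = a + b + 1

/-- The plane `Π(i,j) = P(i,j) ∨ P(i+1,j) ∨ P(i,j+1)` of a face. -/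
noncomputable def facePlane (i : Fin a) (j : Fin b) : Sub n :=
  join₃ (P i.castSucc j.castSucc) (P i.succ j.castSucc) (P i.castSucc j.succ)

/-- The line `P(i,j) ∨ P(i+1,j)` of a horizontal edge. -/
noncomputable def hEdge (i : Fin a) (j : Fin (b + 1)) : Sub n := join₂ (P i.castSucc j) (P i.succ j)

/-- The line `P(i,j) ∨ P(i,j+1)` of a vertical edge. -/
noncomputable def vEdge (i : Fin (a + 1)) (j : Fin b) : Sub n := join₂ (P i j.castSucc) (P i j.succ)

/-- An instance of touching conics of `P`, together with its touching points: each quad is equipped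
with an inscribed conic `conic i j`, and for each edge all the conics of the (one or two) adjacent
quads touch the line of the edge at the same point, `S i j` on a horizontal edge and `T i j` on a
vertical edge.  The touching points are determined by the conics. -/
@[ext]
structure TouchingConics where
  conic : Fin a → Fin b → Set (RP n)
  S : Fin a → Fin (b + 1) → RP n
  T : Fin (a + 1) → Fin b → RP n
  inscribed : ∀ i j, IsInscribedConic (P i.castSucc j.castSucc) (P i.succ j.castSucc)
    (P i.castSucc j.succ) (P i.succ j.succ) (conic i j)
  touches_bottom : ∀ i j,
    TouchesAt (facePlane P i j) (conic i j) (hEdge P i j.castSucc) (S i j.castSucc)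
  touches_top : ∀ i j, TouchesAt (facePlane P i j) (conic i j) (hEdge P i j.succ) (S i j.succ)
  touches_left : ∀ i j,
    TouchesAt (facePlane P i j) (conic i j) (vEdge P i.castSucc j) (T i.castSucc j)
  touches_right : ∀ i j, TouchesAt (facePlane P i j) (conic i j) (vEdge P i.succ j) (T i.succ j)

/-- A Kœnigs net: a non-degenerate Q-net that admits an instance of touching conics. -/
structure IsKoenigs : Prop where
  isQNet : IsQNet P
  isNondegenerate : IsNondegenerate P
  exists_touchingConics : Nonempty (TouchingConics P)

variable {P}

/-- The parameter space of `S` joined by the points `S(i,j)` with `j` fixed. -/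
noncomputable def TouchingConics.hSpace (𝒞 : TouchingConics P) (j : Fin (b + 1)) : Sub n :=
  ⨆ i, (𝒞.S i j).submodule

/-- The parameter space of `T` joined by the points `T(i,j)` with `i` fixed. -/
noncomputable def TouchingConics.vSpace (𝒞 : TouchingConics P) (i : Fin (a + 1)) : Sub n :=
  ⨆ j, (𝒞.T i j).submodule

/-- `Q` is an inscribed quadric of `P` for the instance `𝒞` of touching conics. -/
structure IsInscribedQuadric (𝒞 : TouchingConics P) (Q : Set (RP n)) : Prop where
  isQuadric : IsQuadric Q
  conic_eq : ∀ i j, 𝒞.conic i j = Q ∩ points (facePlane P i j)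
  vSpace_subset : ∀ i, points (𝒞.vSpace i) ⊆ Q
  hSpace_subset : ∀ j, points (𝒞.hSpace j) ⊆ Q

end nets

end KoenigsNet

/-! The problem becomes linear once the vertices have suitable homogeneous coordinates. Let A, B,
B', A' be the vertices of a face in cyclic order. A form defining an inscribed conic does not vanish
at the vertices (`IsInscribedConic.apply_ne_zero`), so the touching points differ from the vertices,
and rescaling makes three of them differences such as A - B. The Gram equations then make the fourth
a difference too and give the Moutard equation A + B' = κ (B + A') with κ ≠ 0
(`IsInscribedConic.moutard`). The first conclusion is a closing condition around the face, so the
scaling exists globally (`TouchingConics.exists_isAdapted`).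

A solution of the Moutard equation is determined by its values on a cross, one row and one column.
For an extensive net the a + b + 1 vectors on any cross therefore form a basis, and a linear
functional may be prescribed there. The functionals that are one on the cross of a vertex solve, as
functions of the vertex, the same Moutard equation as the net (`isMoutard_crossMap`). Hence they fit
together to a symmetric form with value one on all pairs of vertices in a common row or column. Its
restriction to a face plane is forced by the tangencies, and differences within a row or column span
isotropic spaces, so its zero set is an inscribed quadric. Any other form of an inscribed quadric is
proportional to it (`TouchingConics.IsAdapted.eq_zeroSet`).

Two Moutard lifts of the same net differ by a common factor and by weights 1 and t on the black and
white vertices (`exists_eq_chess_smul`); conversely all such weights preserve the Moutard property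
(`IsMoutard.chess_smul`). Thus t ≠ 0 is the parameter of the family. -/

namespace KoenigsNet

/-- The vector `v` represents the point `X` in homogeneous coordinates. -/
def Represents {n : ℕ} (v : Fin (n + 1) → ℝ) (X : RP n) : Prop := X.submodule = ℝ ∙ v

/-! ### Homogeneous coordinates, zero sets and tangency -/

section representatives

variable {n : ℕ} {X Y Z : RP n} {u v w : Fin (n + 1) → ℝ} {W : Sub n} {φ ψ : Form n}
  {C : Set (RP n)}

theorem represents_rep (X : RP n) : Represents X.rep X := X.submodule_eq

theorem represents_mk (hv : v ≠ 0) : Represents v (Projectivization.mk ℝ v hv) :=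
  Projectivization.submodule_mk v hv

theorem Represents.ne_zero (h : Represents v X) : v ≠ 0 := by
  rintro rfl
  have h1 : X.rep ∈ X.submodule := by
    rw [X.submodule_eq]; exact Submodule.mem_span_singleton_self _
  rw [h] at h1
  simp [X.rep_nonzero] at h1

theorem Represents.exists_smul (h : Represents u X) (h' : Represents v X) :
    ∃ c : ℝ, c ≠ 0 ∧ v = c • u := by
  obtain ⟨c, hc⟩ := Submodule.span_singleton_eq_span_singleton.1 (h.symm.trans h')
  exact ⟨c, c.ne_zero, hc.symm⟩

theorem Represents.smul (h : Represents v X) {c : ℝ} (hc : c ≠ 0) : Represents (c • v) X :=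
  h.trans (Submodule.span_singleton_smul_eq (IsUnit.mk0 c hc) v).symm

theorem Represents.unique (h : Represents v X) (h' : Represents v Y) : X = Y :=
  Projectivization.submodule_injective (h.trans h'.symm)

theorem Represents.mem_points (h : Represents v X) : X ∈ points W ↔ v ∈ W := by
  change X.submodule ≤ W ↔ _
  rw [h, Submodule.span_singleton_le_iff_mem]

theorem Represents.mem_zeroSet (h : Represents v X) : X ∈ zeroSet φ ↔ φ v v = 0 := by
  obtain ⟨c, hc, e⟩ := (represents_rep X).exists_smul h
  simp [zeroSet, e, hc]

theorem Represents.join₂ (hu : Represents u X) (hv : Represents v Y) :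
    join₂ X Y = Submodule.span ℝ {u, v} := by
  rw [KoenigsNet.join₂, hu, hv, Submodule.span_insert]

theorem Represents.join₃ (hu : Represents u X) (hv : Represents v Y) (hw : Represents w Z) :
    join₃ X Y Z = Submodule.span ℝ {u, v, w} := by
  rw [KoenigsNet.join₃, hu, hv, hw, Submodule.span_insert, Submodule.span_insert, sup_assoc]

theorem points_subset_zeroSet_iff : points W ⊆ zeroSet φ ↔ ∀ x ∈ W, φ x x = 0 := by
  refine ⟨fun h x hx => ?_, fun h X hX => h _ ((represents_rep X).mem_points.1 hX)⟩
  by_cases h0 : x = 0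
  · simp [h0]
  · exact (represents_mk h0).mem_zeroSet.1 (h ((represents_mk h0).mem_points.2 hx))

theorem zeroSet_inter_points_eq_iff :
    zeroSet φ ∩ points W = zeroSet ψ ∩ points W ↔ ∀ x ∈ W, φ x x = 0 ↔ ψ x x = 0 := by
  constructor
  · intro h x hx
    by_cases h0 : x = 0
    · simp [h0]
    have hr := represents_mk h0
    have := Set.ext_iff.1 h (Projectivization.mk ℝ x h0)
    simpa [hr.mem_zeroSet, hr.mem_points, hx] using this
  · intro h
    ext X
    have hr := represents_rep X
    simp only [Set.mem_inter_iff, hr.mem_zeroSet, hr.mem_points]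
    exact and_congr_left (h _)

theorem Defines.iff (hφ : Defines φ W C) (hψ : Defines ψ W C) :
    ∀ x ∈ W, φ x x = 0 ↔ ψ x x = 0 :=
  zeroSet_inter_points_eq_iff.1 (hφ.2.2.symm.trans hψ.2.2)

theorem exists_ne_zero_of_isSymm (hφ : φ.IsSymm) (h : ∃ x ∈ W, ∃ y ∈ W, φ x y ≠ 0) :
    ∃ x ∈ W, φ x x ≠ 0 := by
  by_contra! h0
  obtain ⟨x, hx, y, hy, hxy⟩ := h
  have h1 := h0 (x + y) (W.add_mem hx hy)
  simp only [map_add, LinearMap.add_apply, h0 x hx, h0 y hy, hφ.eq y x] at h1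
  exact hxy (by linarith)

/-- A touching point is in the kernel of the restriction to the tangent of each form that defines
the conic. -/
theorem TouchesAt.apply_eq_zero {L : Sub n} (h : TouchesAt W C L X) (hL : L ≤ W)
    (hφ : Defines φ W C) (hv : Represents v X) : ∀ y ∈ L, φ v y = 0 := by
  intro y hy
  obtain ⟨ψ, hψ, hX, hk⟩ := h
  have hvL := hv.mem_points.1 hX
  obtain ⟨c, -, e⟩ := (represents_rep X).exists_smul hv
  have hk' : ∀ y ∈ L, ψ v y = 0 := fun y hy => by simp [e, hk y hy]
  have hiff := hφ.iff hψ
  have hs := hφ.1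
  by_contra hne
  have hvv : φ v v = 0 := (hiff v (hL hvL)).2 (hk' v hvL)
  -- On the affine line y + s v the form φ is affine in s with non-zero slope, while ψ is constant.
  -- The zero of φ makes ψ vanish on the whole line, hence φ vanishes at s = 0 and s = 1, which
  -- contradicts the slope.
  have ev : ∀ s : ℝ, φ (y + s • v) (y + s • v) = φ y y + 2 * s * φ v y := fun s => by
    simp only [map_add, LinearMap.add_apply, map_smul, LinearMap.smul_apply, smul_eq_mul,
      hs.eq y v, hvv]
    ring
  have ev' : ∀ s : ℝ, ψ (y + s • v) (y + s • v) = ψ y y := fun s => by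
    simp only [map_add, LinearMap.add_apply, map_smul, LinearMap.smul_apply, smul_eq_mul,
      hψ.1.eq y v, hk' y hy, hk' v hvL]
    ring
  have hmem : ∀ s : ℝ, y + s • v ∈ W := fun s => hL (L.add_mem hy (L.smul_mem s hvL))
  have h1 := (hiff _ (hmem (-φ y y / (2 * φ v y)))).1 (by rw [ev]; field_simp; ring)
  have h2 := (hiff _ (hmem 1)).2 (by rw [ev', ← ev', h1])
  have h3 := (hiff _ (hL hy)).2 (by rw [← ev' (-φ y y / (2 * φ v y)), h1])
  rw [ev, h3] at h2
  apply hne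
  linarith

theorem triple_independent (h : Module.finrank ℝ (Submodule.span ℝ {u, v, w} : Sub n) = 3)
    {a b c : ℝ} (e : a • u + b • v + c • w = 0) : a = 0 ∧ b = 0 ∧ c = 0 := by
  have hli : LinearIndependent ℝ ![u, v, w] := by
    have hr : Set.range ![u, v, w] = {u, v, w} := by
      ext x
      simp only [Matrix.range_cons, Matrix.range_empty, Set.mem_union, Set.mem_singleton_iff,
        Set.mem_empty_iff_false, Set.mem_insert_iff, or_false]
    rw [linearIndependent_iff_card_eq_finrank_span, Set.finrank, hr, h, Fintype.card_fin]
  rw [Fintype.linearIndependent_iff] at hli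
  have := hli ![a, b, c] (by simpa [Fin.sum_univ_three] using e)
  exact ⟨this 0, this 1, this 2⟩

/-- The hyperplane section of a space by a form that does not vanish on it. -/
theorem finrank_inf_ker {f : (Fin (n + 1) → ℝ) →ₗ[ℝ] ℝ} (hu : u ∈ W) (hf : f u ≠ 0) :
    Module.finrank ℝ (W ⊓ LinearMap.ker f : Sub n) + 1 = Module.finrank ℝ W := by
  have h0 : f ≠ 0 := by rintro rfl; simp at hf
  have h1 := Module.Dual.finrank_ker_add_one_of_ne_zero h0
  have h2 := Submodule.finrank_sup_add_finrank_inf_eq W (LinearMap.ker f)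
  have h3 : W ⊔ LinearMap.ker f = ⊤ := by
    rw [eq_top_iff]
    intro x _
    have : x = (f x / f u) • u + (x - (f x / f u) • u) := by abel
    rw [this]
    refine Submodule.add_mem_sup (W.smul_mem _ hu) ?_
    simp [hf]
  rw [h3, finrank_top] at h2
  omega

end representatives
-- Gram equations of a tangential quad
section faces

variable {n : ℕ} {X Y X' Y' Z : RP n} {A B A' B' u v : Fin (n + 1) → ℝ} {W : Sub n} {φ ψ : Form n}
  {C : Set (RP n)}

/-- A conic of rank one is a double line, and hence contains the Laplace points. -/
theorem IsInscribedConic.laplace (hC : IsInscribedConic X Y X' Y' C)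
    (hφ : Defines φ (join₃ X Y X') C) (h3 : Module.finrank ℝ (join₃ X Y X') = 3)
    (hu : u ∈ join₃ X Y X') (hne : φ u u ≠ 0)
    (h1 : ∀ x ∈ join₃ X Y X', φ x x * φ u u = φ u x ^ 2) :
    (∀ x ∈ join₂ X Y ⊓ join₂ X' Y', φ u x = 0) ∧
      (∀ x ∈ join₂ X X' ⊓ join₂ Y Y', φ u x = 0) := by
  have hfr := finrank_inf_ker (f := φ u) hu hne
  have hCM : C = points (join₃ X Y X' ⊓ LinearMap.ker (φ u)) := by
    rw [hφ.2.2]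
    ext Z
    have hr := represents_rep Z
    simp only [Set.mem_inter_iff, hr.mem_zeroSet, hr.mem_points, Submodule.mem_inf,
      LinearMap.mem_ker]
    rw [and_comm]
    refine and_congr_right fun hZ => ?_
    have := h1 _ hZ
    constructor
    · intro h
      rw [h, zero_mul] at this
      exact pow_eq_zero_iff two_ne_zero |>.1 this.symm
    · intro h
      rw [h] at this
      simpa [hne] using this
  obtain ⟨k1, k2⟩ := hC.doubleLine _ (by omega) hCM
  exact ⟨fun x hx => (k1 hx).2, fun x hx => (k2 hx).2⟩

/-- The vector v is a non-zero kernel vector of the restriction to the span of A and B, so the Gram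
determinant vanishes. -/
theorem discrim_eq_zero_of_mem_span_pair (hφ : φ.IsSymm) (hv : v ∈ Submodule.span ℝ {A, B})
    (h0 : v ≠ 0) (hA : φ v A = 0) (hB : φ v B = 0) : φ A A * φ B B = φ A B ^ 2 := by
  obtain ⟨a, b, rfl⟩ := Submodule.mem_span_pair.1 hv
  simp only [map_add, LinearMap.add_apply, map_smul, LinearMap.smul_apply, smul_eq_mul,
    hφ.eq B A] at hA hB
  by_cases ha : a = 0
  · have hb : b ≠ 0 := by rintro rfl; simp [ha] at h0
    subst ha
    simp [hb] at hA hB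
    simp [hA, hB]
  · apply mul_left_cancel₀ ha
    linear_combination φ B B * hA - φ A B * hB

/-- A non-trivial form touching the four edges of a quad does not vanish at a vertex, unless it
is a double line which avoids one of the Laplace points. -/
theorem apply_vertex_ne_zero (hφ : φ.IsSymm) (hW : W ≤ Submodule.span ℝ {A, B, A'})
    (hB : B ∈ W) (hA' : A' ∈ W)
    {α β γ δ : ℝ} (hβ : β ≠ 0) (hγ : γ ≠ 0)
    (e : α • A + β • B + γ • A' + δ • B' = 0)
    (d₁ : φ A A * φ B B = φ A B ^ 2) (d₂ : φ A A * φ A' A' = φ A A' ^ 2)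
    (d₃ : φ B B * φ B' B' = φ B B' ^ 2)
    (hl : ∀ u ∈ W, φ u u ≠ 0 → (∀ x ∈ W, φ x x * φ u u = φ u x ^ 2) →
      φ u (α • A + β • B) = 0 ∧ φ u (α • A + γ • A') = 0)
    (hne : ∃ x ∈ W, φ x x ≠ 0) : φ A A ≠ 0 := by
  intro hAA
  rw [hAA, zero_mul] at d₁ d₂
  have hAB := pow_eq_zero_iff two_ne_zero |>.1 d₁.symm
  have hAA' := pow_eq_zero_iff two_ne_zero |>.1 d₂.symm
  have hBA : φ B A = 0 := by rw [hφ.eq, hAB]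
  have hA'A : φ A' A = 0 := by rw [hφ.eq, hAA']
  have hval : ∀ x ∈ W, ∃ b c : ℝ, φ x x = b ^ 2 * φ B B + 2 * b * c * φ B A' + c ^ 2 * φ A' A' ∧
      φ B x = b * φ B B + c * φ B A' ∧ φ A' x = b * φ B A' + c * φ A' A' := by
    intro x hx
    obtain ⟨a, b, c, rfl⟩ := Submodule.mem_span_triple.1 (hW hx)
    refine ⟨b, c, ?_, ?_, ?_⟩ <;>
    · simp only [map_add, LinearMap.add_apply, map_smul, LinearMap.smul_apply, smul_eq_mul,
        hφ.eq A' B, hAA, hAB, hAA', hBA, hA'A]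
      ring
  have hdisc : φ B B * φ A' A' = φ B A' ^ 2 := by
    have eB' : δ • B' = -(α • A + β • B + γ • A') :=
      eq_neg_of_add_eq_zero_right e
    have f1 : δ * φ B B' = -(β * φ B B + γ * φ B A') := by
      rw [← smul_eq_mul, ← map_smul, eB']
      simp [hBA]
    have f2 : δ ^ 2 * φ B' B' = β ^ 2 * φ B B + 2 * β * γ * φ B A' + γ ^ 2 * φ A' A' := by
      have : δ ^ 2 * φ B' B' = φ (δ • B') (δ • B') := by simp; ring
      rw [this, eB']
      simp only [map_neg, LinearMap.neg_apply, map_add, LinearMap.add_apply, map_smul,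
        LinearMap.smul_apply, smul_eq_mul, hφ.eq A' B, hAA, hAB, hAA', hBA, hA'A]
      ring
    apply mul_left_cancel₀ (pow_ne_zero 2 hγ)
    linear_combination δ ^ 2 * d₃ - φ B B * f2 +
      (δ * φ B B' - (β * φ B B + γ * φ B A')) * f1
  by_cases hBB : φ B B = 0
  · rw [hBB, zero_mul] at hdisc
    have hBA' := pow_eq_zero_iff two_ne_zero |>.1 hdisc.symm
    have hne' : φ A' A' ≠ 0 := by
      obtain ⟨x, hx, hx0⟩ := hne
      obtain ⟨b, c, h1, -, -⟩ := hval x hx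
      intro h0
      simp [hBB, hBA', h0] at h1
      exact hx0 h1
    have := (hl A' hA' hne' fun x hx => by
      obtain ⟨b, c, h1, h2, h3⟩ := hval x hx
      rw [h1, h3, hBB, hBA']; ring).2
    simp [hA'A, hγ, hne'] at this
  · have := (hl B hB hBB fun x hx => by
      obtain ⟨b, c, h1, h2, h3⟩ := hval x hx
      rw [h1, h2]; linear_combination c ^ 2 * hdisc).1
    simp [hBA, hβ, hBB] at this

/-- These are the Gram equations for B' = α A + β B + γ A', normalised so that φ A A = 1, with m = φ
B A' and τ = φ A' B'. The hypothesis `hm` covers the double line m = 1, where the Laplace points lie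
in the kernel. For τ = 1 the spurious root α = 1 - 2 β forces m = 1; for τ = -1 the equations force
β - γ = 1 and then α = 0. -/
theorem quad_coefficients {α β γ m τ : ℝ} (hα : α ≠ 0) (hβ : β ≠ 0) (hγ : γ ≠ 0) (hτ : τ ^ 2 = 1)
    (h₁ : α + β + γ * m = 1) (h₂ : α + β * m + γ = τ) (h₃ : α * (α + β + γ) + β + τ * γ = 1)
    (hm : m = 1 → α + β = 0 ∧ α + γ = 0) : τ = 1 ∧ α = -1 ∧ β = γ := by
  rcases (Commute.all τ 1).sq_eq_sq_iff_eq_or_eq_neg.1 (by rw [hτ, one_pow]) with rfl | rfl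
  · refine ⟨rfl, ?_⟩
    by_cases h : m = 1
    · obtain ⟨h4, h5⟩ := hm h
      subst h
      exact ⟨by linarith, by linarith⟩
    · have hbc : β = γ := by
        have : (β - γ) * (1 - m) = 0 := by linear_combination h₁ - h₂
        rcases mul_eq_zero.1 this with h' | h'
        · linarith
        · exact absurd (by linarith) h
      subst hbc
      refine ⟨?_, rfl⟩
      have : (α + 1) * (α - 1 + 2 * β) = 0 := by linear_combination h₃
      rcases mul_eq_zero.1 this with h' | h'
      · linarith
      · have : β * (m - 1) = 0 := by linear_combination h₁ - h'
        rcases mul_eq_zero.1 this with h'' | h''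
        · exact absurd h'' hβ
        · exact absurd (by linarith) h
  · exfalso
    have e1 : (β - γ) * (1 - m) = 2 := by linear_combination h₁ - h₂
    have e2 : (β - γ) * α = -(β + γ) * (β - γ - 1) := by
      linear_combination (β - γ) / 2 * (h₁ + h₂) + (β + γ) / 2 * e1
    have e3 : (β - γ - 1) * (4 * β * γ) = 0 := by
      linear_combination (-(β - γ) ^ 2) * h₃ +
        ((β - γ) * α - (β + γ) * (β - γ - 1) + (β + γ) * (β - γ)) * e2
    have e4 : β - γ - 1 = 0 := by
      rcases mul_eq_zero.1 e3 with h | h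
      · exact h
      · simp [hβ, hγ] at h
    rw [e4, mul_zero] at e2
    rcases mul_eq_zero.1 e2 with h | h
    · linarith
    · exact hα h

end faces
-- Inscribed conics of a single face
section faces

variable {n : ℕ} {X Y X' Y' S S' T T' : RP n} {A B A' B' u v : Fin (n + 1) → ℝ} {W : Sub n}
  {φ ψ : Form n} {C : Set (RP n)}

/-- The vectors `A, B, B', A'` represent, in cyclic order, the vertices of a planar quad in general
position. -/
structure IsQuad (A B A' B' : Fin (n + 1) → ℝ) : Prop where
  finrank_eq : Module.finrank ℝ (Submodule.span ℝ {A, B, A'} : Sub n) = 3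
  exists_relation : ∃ α β γ : ℝ, α ≠ 0 ∧ β ≠ 0 ∧ γ ≠ 0 ∧ B' = α • A + β • B + γ • A'

theorem IsQuad.mem_span (h : IsQuad A B A' B') : B' ∈ Submodule.span ℝ {A, B, A'} := by
  obtain ⟨α, β, γ, -, -, -, e⟩ := h.exists_relation
  exact Submodule.mem_span_triple.2 ⟨α, β, γ, e.symm⟩

theorem IsQuad.of_finrank {V : Sub n} (hV : Module.finrank ℝ V = 3) (hA : A ∈ V) (hB : B ∈ V)
    (hA' : A' ∈ V) (hB' : B' ∈ V)
    (h₁ : Module.finrank ℝ (Submodule.span ℝ {A, B, A'} : Sub n) = 3)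
    (h₂ : Module.finrank ℝ (Submodule.span ℝ {A, B, B'} : Sub n) = 3)
    (h₃ : Module.finrank ℝ (Submodule.span ℝ {A, A', B'} : Sub n) = 3)
    (h₄ : Module.finrank ℝ (Submodule.span ℝ {B, A', B'} : Sub n) = 3) : IsQuad A B A' B' := by
  refine ⟨h₁, ?_⟩
  have hle : Submodule.span ℝ {A, B, A'} ≤ V := by
    rw [Submodule.span_le]
    rintro x (rfl | rfl | rfl) <;> assumption
  rw [← Submodule.eq_of_le_of_finrank_eq hle (h₁.trans hV.symm)] at hB'
  obtain ⟨α, β, γ, e⟩ := Submodule.mem_span_triple.1 hB'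
  refine ⟨α, β, γ, ?_, ?_, ?_, e.symm⟩
  · rintro rfl
    have := triple_independent h₄ (a := β) (b := γ) (c := -1) (by rw [← e]; module)
    simp at this
  · rintro rfl
    have := triple_independent h₃ (a := α) (b := γ) (c := -1) (by rw [← e]; module)
    simp at this
  · rintro rfl
    have := triple_independent h₂ (a := α) (b := β) (c := -1) (by rw [← e]; module)
    simp at this

theorem TouchesAt.discrim_eq_zero (h : TouchesAt W C (join₂ X Y) S) (hL : join₂ X Y ≤ W)
    (hφ : Defines φ W C) (hA : Represents A X) (hB : Represents B Y) :
    φ A A * φ B B = φ A B ^ 2 := by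
  have hr := represents_rep S
  have hk := h.apply_eq_zero hL hφ hr
  obtain ⟨-, -, hS, -⟩ := h
  have hS := hr.mem_points.1 hS
  rw [hA.join₂ hB] at hS hk
  exact discrim_eq_zero_of_mem_span_pair hφ.1 hS hr.ne_zero
    (hk _ (Submodule.subset_span (by simp))) (hk _ (Submodule.subset_span (by simp)))

section

variable (hA : Represents A X) (hB : Represents B Y) (hA' : Represents A' X')
  (hB' : Represents B' Y') (hq : IsQuad A B A' B')
include hA hB hA' hB' hq

theorem IsQuad.join₂_le :
    join₂ X Y ≤ join₃ X Y X' ∧ join₂ X' Y' ≤ join₃ X Y X' ∧ join₂ X X' ≤ join₃ X Y X' ∧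
      join₂ Y Y' ≤ join₃ X Y X' := by
  have hm := hq.mem_span
  rw [hA.join₂ hB, hA'.join₂ hB', hA.join₂ hA', hB.join₂ hB', hA.join₃ hB hA']
  have m : ∀ x ∈ ({A, B, A'} : Set (Fin (n + 1) → ℝ)), x ∈ Submodule.span ℝ {A, B, A'} :=
    fun x hx => Submodule.subset_span hx
  refine ⟨?_, ?_, ?_, ?_⟩ <;> rw [Submodule.span_le] <;> rintro x (rfl | rfl)
  all_goals first | exact hm | exact m _ (by simp)

/-- The forms defining an inscribed conic do not vanish at the vertices of the quad. -/
theorem IsInscribedConic.apply_ne_zero (hC : IsInscribedConic X Y X' Y' C)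
    (hφ : Defines φ (join₃ X Y X') C) :
    φ A A ≠ 0 ∧ φ B B ≠ 0 ∧ φ A' A' ≠ 0 ∧ φ B' B' ≠ 0 := by
  obtain ⟨l₁, l₂, l₃, l₄⟩ := hq.join₂_le hA hB hA' hB'
  obtain ⟨S₁, hS₁⟩ := hC.touches₁
  obtain ⟨S₂, hS₂⟩ := hC.touches₂
  obtain ⟨S₃, hS₃⟩ := hC.touches₃
  obtain ⟨S₄, hS₄⟩ := hC.touches₄
  have d₁ := hS₁.discrim_eq_zero l₁ hφ hA hB
  have d₂ := hS₂.discrim_eq_zero l₂ hφ hA' hB'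
  have d₃ := hS₃.discrim_eq_zero l₃ hφ hA hA'
  have d₄ := hS₄.discrim_eq_zero l₄ hφ hB hB'
  have hne := exists_ne_zero_of_isSymm hφ.1 hφ.2.1
  obtain ⟨α, β, γ, hα, hβ, hγ, e⟩ := hq.exists_relation
  have hW := hA.join₃ hB hA'
  have mB' := hq.mem_span
  rw [← hW] at mB'
  have mA : A ∈ join₃ X Y X' := by rw [hW]; exact Submodule.subset_span (by simp)
  have mB : B ∈ join₃ X Y X' := by rw [hW]; exact Submodule.subset_span (by simp)
  have mA' : A' ∈ join₃ X Y X' := by rw [hW]; exact Submodule.subset_span (by simp)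
  have h3 : Module.finrank ℝ (join₃ X Y X') = 3 := by rw [hW]; exact hq.finrank_eq
  have hL : ∀ u ∈ join₃ X Y X', φ u u ≠ 0 →
      (∀ x ∈ join₃ X Y X', φ x x * φ u u = φ u x ^ 2) →
      φ u (α • A + β • B) = 0 ∧ φ u (α • A + γ • A') = 0 := by
    intro u hu hne h1
    obtain ⟨k₁, k₂⟩ := hC.laplace hφ h3 hu hne h1
    rw [hA.join₂ hB, hA'.join₂ hB'] at k₁
    rw [hA.join₂ hA', hB.join₂ hB'] at k₂
    refine ⟨k₁ _ ⟨Submodule.mem_span_pair.2 ⟨α, β, rfl⟩, Submodule.mem_span_pair.2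
      ⟨-γ, 1, by rw [e]; module⟩⟩, k₂ _ ⟨Submodule.mem_span_pair.2 ⟨α, γ, rfl⟩,
      Submodule.mem_span_pair.2 ⟨-β, 1, by rw [e]; module⟩⟩⟩
  have hs := hφ.1
  have dd : ∀ {x y : Fin (n + 1) → ℝ}, φ x x * φ y y = φ x y ^ 2 →
      φ y y * φ x x = φ y x ^ 2 := fun {x y} h => by rw [hs.eq y x, ← h, mul_comm]
  have n1 : (-1 : ℝ) ≠ 0 := by norm_num
  refine ⟨?_, ?_, ?_, ?_⟩
  -- The same lemma serves all four vertices: each in turn plays the role of A, its neighbours those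
  -- of B and A', and the linear relation is rearranged. The Laplace vectors change only by sign or
  -- order of summands.
  · exact apply_vertex_ne_zero hs hW.le mB mA' hβ hγ (δ := -1) (B' := B') (by rw [e]; module)
      d₁ d₃ d₄ hL hne
  · refine apply_vertex_ne_zero hs (A' := B') ?_ mA mB' hα n1 (α := β) (δ := γ) (B' := A')
      (by rw [e]; module) (dd d₁) d₄ d₃ ?_ hne
    · rw [hW, Submodule.span_le]
      rintro w (rfl | rfl | rfl)
      · exact Submodule.subset_span (by simp)
      · exact Submodule.subset_span (by simp)
      · exact Submodule.mem_span_triple.2 ⟨-β / γ, -α / γ, 1 / γ, by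
          rw [e]; match_scalars <;> field_simp <;> ring⟩
    · intro u hu hne h1
      obtain ⟨k₁, k₂⟩ := hL u hu hne h1
      refine ⟨by rw [add_comm (β • B)]; exact k₁, ?_⟩
      have : β • B + (-1 : ℝ) • B' = -(α • A + γ • A') := by rw [e]; module
      rw [this, map_neg, k₂, neg_zero]
  · refine apply_vertex_ne_zero hs (A' := A) ?_ mB' mA n1 hα (α := γ) (δ := β) (B := B') (B' := B)
      (by rw [e]; module) d₂ (dd d₃) (dd d₄) ?_ hne
    · rw [hW, Submodule.span_le]
      rintro w (rfl | rfl | rfl)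
      · exact Submodule.subset_span (by simp)
      · exact Submodule.mem_span_triple.2 ⟨-γ / β, 1 / β, -α / β, by
          rw [e]; match_scalars <;> field_simp <;> ring⟩
      · exact Submodule.subset_span (by simp)
    · intro u hu hne h1
      obtain ⟨k₁, k₂⟩ := hL u hu hne h1
      refine ⟨?_, by rw [add_comm (γ • A')]; exact k₂⟩
      have : γ • A' + (-1 : ℝ) • B' = -(α • A + β • B) := by rw [e]; module
      rw [this, map_neg, k₁, neg_zero]
  · refine apply_vertex_ne_zero hs (A' := A') (B := B) ?_ mB mA' hβ hγ (α := -1) (δ := α) (B' := A)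
      (by rw [e]; module) (dd d₄) (dd d₂) (dd d₁) ?_ hne
    · rw [hW, Submodule.span_le]
      rintro w (rfl | rfl | rfl)
      · exact Submodule.mem_span_triple.2 ⟨1 / α, -β / α, -γ / α, by
          rw [e]; match_scalars <;> field_simp <;> ring⟩
      · exact Submodule.subset_span (by simp)
      · exact Submodule.subset_span (by simp)
    · intro u hu hne h1
      obtain ⟨k₁, k₂⟩ := hL u hu hne h1
      constructor
      · have : (-1 : ℝ) • B' + β • B = -(α • A + γ • A') := by rw [e]; module
        rw [this, map_neg, k₂, neg_zero]
      · have : (-1 : ℝ) • B' + γ • A' = -(α • A + β • B) := by rw [e]; module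
        rw [this, map_neg, k₁, neg_zero]

/-- If vertices are represented so that three of the touching points are differences, then so is the
fourth, and the two sums of opposite vertices are proportional. -/
theorem IsInscribedConic.moutard (hC : IsInscribedConic X Y X' Y' C) {τ : ℝ} (hτ : τ ≠ 0)
    (hS : TouchesAt (join₃ X Y X') C (join₂ X Y) S) (rS : Represents (A - B) S)
    (hS' : TouchesAt (join₃ X Y X') C (join₂ X' Y') S') (rS' : Represents (A' - τ • B') S')
    (hT : TouchesAt (join₃ X Y X') C (join₂ X X') T) (rT : Represents (A - A') T)
    (hT' : TouchesAt (join₃ X Y X') C (join₂ Y Y') T') (rT' : Represents (B - B') T') :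
    τ = 1 ∧ ∃ κ : ℝ, κ ≠ 0 ∧ A + B' = κ • (B + A') := by
  obtain ⟨l₁, l₂, l₃, l₄⟩ := hq.join₂_le hA hB hA' hB'
  obtain ⟨φ, hφ⟩ := hC.isConic
  obtain ⟨hne, -, -, -⟩ := hC.apply_ne_zero hA hB hA' hB' hq hφ
  have k₁ := hS.apply_eq_zero l₁ hφ rS
  have k₂ := hS'.apply_eq_zero l₂ hφ rS'
  have k₃ := hT.apply_eq_zero l₃ hφ rT
  have k₄ := hT'.apply_eq_zero l₄ hφ rT'
  rw [hA.join₂ hB] at k₁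
  rw [hA'.join₂ hB'] at k₂
  rw [hA.join₂ hA'] at k₃
  rw [hB.join₂ hB'] at k₄
  have s : ∀ {x y z : Fin (n + 1) → ℝ}, x ∈ ({y, z} : Set _) → x ∈ Submodule.span ℝ {y, z} :=
    fun h => Submodule.subset_span h
  have a₁ := k₁ A (s (by simp))
  have a₂ := k₁ B (s (by simp))
  have a₃ := k₂ A' (s (by simp))
  have a₄ := k₂ B' (s (by simp))
  have a₅ := k₃ A (s (by simp))
  have a₆ := k₃ A' (s (by simp))
  have a₇ := k₄ B (s (by simp))
  have a₈ := k₄ B' (s (by simp))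
  have hs := hφ.1
  simp only [map_sub, LinearMap.sub_apply, map_smul, LinearMap.smul_apply, smul_eq_mul,
    hs.eq B A, hs.eq A' A, hs.eq B' B, hs.eq B' A'] at a₁ a₂ a₃ a₄ a₅ a₆ a₇ a₈
  -- Each touching point is orthogonal to its edge, so all Gram entries along the edges equal c, up
  -- to the factor τ on A'B'. The only free entry is φ B A'.
  set c := φ A A with hc
  have bAB : φ A B = c := by linarith
  have bBB : φ B B = c := by linarith
  have bAA' : φ A A' = c := by linarith
  have bA'A' : φ A' A' = c := by linarith
  have bBB' : φ B B' = c := by linarith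
  have bB'B' : φ B' B' = c := by linarith
  rw [bA'A'] at a₃
  rw [bB'B'] at a₄
  have hτ2 : τ ^ 2 = 1 := by
    apply mul_right_cancel₀ hne
    linear_combination -a₃ - τ * a₄
  have bA'B' : φ A' B' = τ * c := by linarith
  obtain ⟨α, β, γ, hα, hβ, hγ, e⟩ := hq.exists_relation
  have h₁ : φ B B' = α * c + β * c + γ * φ B A' := by
    rw [e]; simp [bBB, hs.eq B A, bAB]
  have h₂ : φ A' B' = α * c + β * φ B A' + γ * c := by
    rw [e]; simp [hs.eq A' A, hs.eq A' B, bAA', bA'A']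
  have h₀ : φ A B' = α * c + β * c + γ * c := by
    rw [e]; simp [bAA', bAB, hc]
  have h₃ : φ B' B' = α * φ A B' + β * φ B B' + γ * φ A' B' := by
    conv_lhs => rw [e]
    simp [e]
  rw [h₀, bB'B', bBB', bA'B'] at h₃
  rw [bBB'] at h₁
  rw [bA'B'] at h₂
  obtain ⟨rfl, rfl, rfl⟩ := quad_coefficients (m := φ B A' / c) hα hβ hγ hτ2
    (by field_simp; linarith) (by field_simp; linarith)
    (by apply mul_right_cancel₀ hne; linear_combination -h₃) (by
      intro hm
      rw [div_eq_one_iff_eq hne] at hm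
      have hW := hA.join₃ hB hA'
      obtain ⟨k₁, k₂⟩ := hC.laplace hφ (by rw [hW]; exact hq.finrank_eq) (u := A)
        (by rw [hW]; exact Submodule.subset_span (by simp)) hne (by
          intro x hx
          rw [hW] at hx
          obtain ⟨p, q, r, rfl⟩ := Submodule.mem_span_triple.1 hx
          simp only [map_add, LinearMap.add_apply, map_smul, LinearMap.smul_apply, smul_eq_mul,
            hs.eq B A, hs.eq A' A, hs.eq A' B, bAB, bAA', bBB, bA'A', hm, ← hc]
          ring)
      rw [hA.join₂ hB, hA'.join₂ hB'] at k₁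
      rw [hA.join₂ hA', hB.join₂ hB'] at k₂
      have z₁ := k₁ (α • A + β • B) ⟨Submodule.mem_span_pair.2 ⟨α, β, rfl⟩,
        Submodule.mem_span_pair.2 ⟨-γ, 1, by rw [e]; module⟩⟩
      have z₂ := k₂ (α • A + γ • A') ⟨Submodule.mem_span_pair.2 ⟨α, γ, rfl⟩,
        Submodule.mem_span_pair.2 ⟨-β, 1, by rw [e]; module⟩⟩
      simp only [map_add, map_smul, smul_eq_mul, bAB, bAA', ← hc] at z₁ z₂
      constructor <;> apply mul_right_cancel₀ hne <;> linarith)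
  exact ⟨rfl, β, hβ, by rw [e]; module⟩

end

end faces

/-! ### Induction on grids -/

section grids

/-- Transfers statements proved face by face to all edges: every grid line is the lower or the upper
side of a strip of faces, because there is at least one strip. -/
theorem forall_fin_of_castSucc_of_succ {b : ℕ} (hb : 1 ≤ b) {motive : Fin (b + 1) → Prop}
    (h₁ : ∀ j : Fin b, motive j.castSucc) (h₂ : ∀ j : Fin b, motive j.succ) : ∀ j, motive j := by
  intro j
  refine Fin.cases ?_ h₂ j
  exact h₁ ⟨0, hb⟩

/-- Propagation in both directions from a start that may be an interior index. -/
theorem forall_fin_of_iff {m : ℕ} {motive : Fin (m + 1) → Prop} (i₀ : Fin (m + 1))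
    (h₀ : motive i₀) (h : ∀ i : Fin m, motive i.castSucc ↔ motive i.succ) : ∀ i, motive i := by
  have key : ∀ i, motive i ↔ motive 0 := fun i =>
    Fin.induction Iff.rfl (fun i hi => (h i).symm.trans hi) i
  exact fun i => (key i).2 ((key i₀).1 h₀)

/-- A closed multiplicative one-form on a grid is exact. -/
theorem exists_potential {a b : ℕ} (f : Fin a → Fin (b + 1) → ℝ) (g : Fin (a + 1) → Fin b → ℝ)
    (hf : ∀ i j, f i j ≠ 0) (hg : ∀ i j, g i j ≠ 0)
    (hc : ∀ i j, g i.succ j * f i j.castSucc = f i j.succ * g i.castSucc j) :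
    ∃ μ : Fin (a + 1) → Fin (b + 1) → ℝ, (∀ i j, μ i j ≠ 0) ∧
      (∀ i j, μ i.succ j = f i j * μ i.castSucc j) ∧
      (∀ i j, μ i j.succ = g i j * μ i j.castSucc) := by
  -- The potential integrates along the bottom row and then up the columns; closedness carries the
  -- horizontal relation from each row to the next.
  let r : Fin (a + 1) → ℝ := fun i => Fin.induction (motive := fun _ => ℝ) 1 (fun k m => f k 0 * m) i
  have r0 : r 0 = 1 := rfl
  have rs : ∀ i : Fin a, r i.succ = f i 0 * r i.castSucc := fun i => Fin.induction_succ _ _ i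
  let c : Fin (a + 1) → Fin (b + 1) → ℝ := fun i j =>
    Fin.induction (motive := fun _ => ℝ) 1 (fun k m => g i k * m) j
  have c0 : ∀ i, c i 0 = 1 := fun i => rfl
  have cs : ∀ i (j : Fin b), c i j.succ = g i j * c i j.castSucc :=
    fun i j => Fin.induction_succ _ _ j
  have hr : ∀ i, r i ≠ 0 := fun i => Fin.induction (by simp [r0])
    (fun i hi => by rw [rs]; exact mul_ne_zero (hf _ _) hi) i
  have hcn : ∀ i j, c i j ≠ 0 := fun i j => Fin.induction (by simp [c0])
    (fun j hj => by rw [cs]; exact mul_ne_zero (hg _ _) hj) j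
  refine ⟨fun i j => r i * c i j, fun i j => mul_ne_zero (hr i) (hcn i j), fun i j => ?_,
    fun i j => by simp only [cs]; ring⟩
  induction j using Fin.induction with
  | zero => simp only [c0, rs]; ring
  | succ j ih =>
    simp only [cs] at ih ⊢
    linear_combination g i.succ j * ih + r i.castSucc * c i.castSucc j.castSucc * hc i j

end grids

/-! ### Adapted homogeneous coordinates -/

section lifts

variable {a b n : ℕ} {P : Net a b n}

theorem IsNondegenerate.isQuad (hQ : IsQNet P) (hN : IsNondegenerate P) (i : Fin a) (j : Fin b)
    {A B A' B' : Fin (n + 1) → ℝ} (hA : Represents A (P i.castSucc j.castSucc))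
    (hB : Represents B (P i.succ j.castSucc)) (hA' : Represents A' (P i.castSucc j.succ))
    (hB' : Represents B' (P i.succ j.succ)) : IsQuad A B A' B' := by
  obtain ⟨V, hV, mA, mB, mA', mB'⟩ := hQ i j
  refine IsQuad.of_finrank hV (hA.mem_points.1 mA) (hB.mem_points.1 mB) (hA'.mem_points.1 mA')
    (hB'.mem_points.1 mB') ?_ ?_ ?_ ?_
  · rw [← hA.join₃ hB hA']; exact hN.triple₁ i j
  · rw [← hA.join₃ hB hB']; exact hN.triple₂ i j
  · rw [← hA.join₃ hA' hB']; exact hN.triple₃ i j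
  · rw [← hB.join₃ hA' hB']; exact hN.triple₄ i j

/-- Homogeneous coordinates of a net such that the touching points of an instance of touching
conics are represented by differences. -/
structure TouchingConics.IsAdapted (𝒞 : TouchingConics P)
    (p : Fin (a + 1) → Fin (b + 1) → Fin (n + 1) → ℝ) : Prop where
  represents : ∀ i j, Represents (p i j) (P i j)
  represents_S : ∀ i j, Represents (p i.castSucc j - p i.succ j) (𝒞.S i j)
  represents_T : ∀ i j, Represents (p i j.castSucc - p i j.succ) (𝒞.T i j)

/-- The sums of opposite vertices of the faces are proportional. -/
def IsMoutard {M : Type*} [AddCommGroup M] [Module ℝ M] (κ : Fin a → Fin b → ℝ)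
    (f : Fin (a + 1) → Fin (b + 1) → M) : Prop :=
  ∀ i j, f i.castSucc j.castSucc + f i.succ j.succ =
    κ i j • (f i.succ j.castSucc + f i.castSucc j.succ)

/-- A touching point is orthogonal to its edge, so it cannot be a vertex where φ does not vanish;
both of its coefficients are therefore non-zero. -/
theorem TouchesAt.exists_represents_sub {X Y S : RP n} {A B : Fin (n + 1) → ℝ} {W : Sub n}
    {φ : Form n} {C : Set (RP n)} (h : TouchesAt W C (join₂ X Y) S) (hL : join₂ X Y ≤ W)
    (hφ : Defines φ W C) (hA : Represents A X) (hB : Represents B Y) (hAA : φ A A ≠ 0)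
    (hBB : φ B B ≠ 0) : ∃ σ : ℝ, σ ≠ 0 ∧ Represents (A - σ • B) S := by
  have hr := represents_rep S
  have hk := h.apply_eq_zero hL hφ hr
  obtain ⟨-, -, hS, -⟩ := h
  have hS := hr.mem_points.1 hS
  rw [hA.join₂ hB] at hS hk
  have h0 := hr.ne_zero
  have hkA := hk A (Submodule.subset_span (by simp))
  have hkB := hk B (Submodule.subset_span (by simp))
  obtain ⟨x, y, e⟩ := Submodule.mem_span_pair.1 hS
  rw [← e] at hr h0 hkA hkB
  have hx : x ≠ 0 := by
    rintro rfl
    have hy : y ≠ 0 := by rintro rfl; simp at h0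
    simp [hy, hBB] at hkB
  have hy : y ≠ 0 := by
    rintro rfl
    simp [hx, hAA] at hkA
  refine ⟨-(y / x), neg_ne_zero.2 (div_ne_zero hy hx), ?_⟩
  have : A - (-(y / x)) • B = x⁻¹ • (x • A + y • B) := by
    match_scalars <;> field_simp
  rw [this]
  exact hr.smul (inv_ne_zero hx)

variable (hQ : IsQNet P) (hN : IsNondegenerate P)
include hQ hN

theorem TouchingConics.IsAdapted.moutard {𝒞 : TouchingConics P}
    {p : Fin (a + 1) → Fin (b + 1) → Fin (n + 1) → ℝ} (h : 𝒞.IsAdapted p) :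
    ∃ κ : Fin a → Fin b → ℝ, (∀ i j, κ i j ≠ 0) ∧ IsMoutard κ p := by
  have key : ∀ (i : Fin a) (j : Fin b), ∃ κ : ℝ, κ ≠ 0 ∧ p i.castSucc j.castSucc + p i.succ j.succ =
      κ • (p i.succ j.castSucc + p i.castSucc j.succ) := by
    intro i j
    exact ((𝒞.inscribed i j).moutard (h.represents _ _) (h.represents _ _) (h.represents _ _)
      (h.represents _ _) (hN.isQuad hQ i j (h.represents _ _) (h.represents _ _)
      (h.represents _ _) (h.represents _ _)) one_ne_zero (𝒞.touches_bottom i j)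
      (h.represents_S _ _) (𝒞.touches_top i j) (by rw [one_smul]; exact h.represents_S _ _)
      (𝒞.touches_left i j) (h.represents_T _ _) (𝒞.touches_right i j) (h.represents_T _ _)).2
  choose κ h0 h1 using key
  exact ⟨κ, h0, h1⟩

/-- The ratios that turn the touching points into differences form a multiplicative one-form on the
edges. The conclusion τ = 1 of `IsInscribedConic.moutard` says that it is closed, and its potential
rescales the vertices. -/
theorem TouchingConics.exists_isAdapted (ha : 1 ≤ a) (hb : 1 ≤ b) (𝒞 : TouchingConics P) :
    ∃ p, 𝒞.IsAdapted p := by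
  have R : ∀ i j, Represents (P i j).rep (P i j) := fun i j => represents_rep _
  have hq := fun i j => hN.isQuad hQ i j (R _ _) (R _ _) (R _ _) (R _ _)
  have hS : ∀ (i : Fin a) (j : Fin (b + 1)), ∃ σ : ℝ, σ ≠ 0 ∧
      Represents ((P i.castSucc j).rep - σ • (P i.succ j).rep) (𝒞.S i j) := by
    intro i
    refine forall_fin_of_castSucc_of_succ hb (fun j => ?_) (fun j => ?_)
    all_goals
      obtain ⟨φ, hφ⟩ := (𝒞.inscribed i j).isConic
      obtain ⟨n₁, n₂, n₃, n₄⟩ :=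
        (𝒞.inscribed i j).apply_ne_zero (R _ _) (R _ _) (R _ _) (R _ _) (hq i j) hφ
      obtain ⟨l₁, l₂, -, -⟩ := (hq i j).join₂_le (R _ _) (R _ _) (R _ _) (R _ _)
    · exact (𝒞.touches_bottom i j).exists_represents_sub l₁ hφ (R _ _) (R _ _) n₁ n₂
    · exact (𝒞.touches_top i j).exists_represents_sub l₂ hφ (R _ _) (R _ _) n₃ n₄
  have hT : ∀ (j : Fin b) (i : Fin (a + 1)), ∃ σ : ℝ, σ ≠ 0 ∧
      Represents ((P i j.castSucc).rep - σ • (P i j.succ).rep) (𝒞.T i j) := by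
    intro j
    refine forall_fin_of_castSucc_of_succ ha (fun i => ?_) (fun i => ?_)
    all_goals
      obtain ⟨φ, hφ⟩ := (𝒞.inscribed i j).isConic
      obtain ⟨n₁, n₂, n₃, n₄⟩ :=
        (𝒞.inscribed i j).apply_ne_zero (R _ _) (R _ _) (R _ _) (R _ _) (hq i j) hφ
      obtain ⟨-, -, l₁, l₂⟩ := (hq i j).join₂_le (R _ _) (R _ _) (R _ _) (R _ _)
    · exact (𝒞.touches_left i j).exists_represents_sub l₁ hφ (R _ _) (R _ _) n₁ n₃
    · exact (𝒞.touches_right i j).exists_represents_sub l₂ hφ (R _ _) (R _ _) n₂ n₄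
  choose f hf rf using hS
  choose g hg rg using hT
  obtain ⟨μ, hμ, hμf, hμg⟩ := exists_potential f (fun i j => g j i) hf (fun i j => hg j i) (by
    intro i j
    have nz : f i j.castSucc * g j i.succ ≠ 0 := mul_ne_zero (hf _ _) (hg _ _)
    have RB := (R i.succ j.castSucc).smul (hf i j.castSucc)
    have RA' := (R i.castSucc j.succ).smul (hg j i.castSucc)
    have RB' := (R i.succ j.succ).smul nz
    -- B, A' and B' are scaled along the bottom, the left and then the right edge, so three touching
    -- points are differences. The defect on the top edge is τ, the quotient of the products of
    -- ratios along the two paths to the opposite vertex.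
    have := ((𝒞.inscribed i j).moutard (R _ _) RB RA' RB' (hN.isQuad hQ i j (R _ _) RB RA' RB')
      (τ := f i j.succ * g j i.castSucc / (f i j.castSucc * g j i.succ))
      (div_ne_zero (mul_ne_zero (hf _ _) (hg _ _)) nz)
      (𝒞.touches_bottom i j) (rf _ _) (𝒞.touches_top i j) (by
        convert (rf i j.succ).smul (hg j i.castSucc) using 1
        have h1 := hf i j.castSucc
        have h2 := hg j i.succ
        match_scalars <;> field_simp)
      (𝒞.touches_left i j) (rg _ _) (𝒞.touches_right i j) (by
        convert (rg j i.succ).smul (hf i j.castSucc) using 1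
        module)).1
    rw [div_eq_one_iff_eq nz] at this
    rw [this, mul_comm])
  refine ⟨fun i j => μ i j • (P i j).rep, fun i j => (R i j).smul (hμ i j), fun i j => ?_,
    fun i j => ?_⟩
  · convert (rf i j).smul (hμ i.castSucc j) using 1
    rw [hμf]; module
  · convert (rg j i).smul (hμ i j.castSucc) using 1
    rw [hμg]; module

end lifts

/-! ### The discrete Moutard equation -/

section moutard

variable {a b : ℕ} {M : Type*} [AddCommGroup M] [Module ℝ M] {κ : Fin a → Fin b → ℝ}
  {f : Fin (a + 1) → Fin (b + 1) → M}

theorem IsMoutard.swap (h : IsMoutard κ f) : IsMoutard (fun j i => κ i j) (fun j i => f i j) := by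
  intro j i
  simp only
  rw [h i j, add_comm (f i.succ j.castSucc)]

theorem IsMoutard.map {N : Type*} [AddCommGroup N] [Module ℝ N] (h : IsMoutard κ f)
    (g : M →ₗ[ℝ] N) : IsMoutard κ (fun i j => g (f i j)) := by
  intro i j
  simp only
  rw [← map_add, h i j, map_smul, map_add]

theorem IsMoutard.sub {g : Fin (a + 1) → Fin (b + 1) → M} (hf : IsMoutard κ f)
    (hg : IsMoutard κ g) : IsMoutard κ (fun i j => f i j - g i j) := by
  intro i j
  have h₁ := hf i j
  have h₂ := hg i j
  simp only
  rw [sub_add_sub_comm, h₁, h₂]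
  module

/-- A solution of the Moutard equation is determined by its values on a cross. -/
theorem IsMoutard.mem_of_cross (hκ : ∀ i j, κ i j ≠ 0) (h : IsMoutard κ f) (U : Submodule ℝ M)
    (i₀ : Fin (a + 1)) (j₀ : Fin (b + 1)) (hr : ∀ i, f i j₀ ∈ U) (hc : ∀ j, f i₀ j ∈ U) :
    ∀ i j, f i j ∈ U := by
  have key : ∀ j, ∀ i, f i j ∈ U := by
    refine forall_fin_of_iff j₀ hr fun j => ?_
    constructor
    · intro hj
      refine forall_fin_of_iff i₀ (hc _) fun i => ?_
      have e := h i j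
      constructor
      · intro hi
        rw [show f i.succ j.succ = κ i j • (f i.succ j.castSucc + f i.castSucc j.succ)
          - f i.castSucc j.castSucc by rw [← e]; abel]
        exact U.sub_mem (U.smul_mem _ (U.add_mem (hj _) hi)) (hj _)
      · intro hi
        rw [show f i.castSucc j.succ = (κ i j)⁻¹ • (f i.castSucc j.castSucc + f i.succ j.succ)
          - f i.succ j.castSucc by rw [e, inv_smul_smul₀ (hκ i j)]; abel]
        exact U.sub_mem (U.smul_mem _ (U.add_mem (hj _) hi)) (hj _)
    · intro hj
      refine forall_fin_of_iff i₀ (hc _) fun i => ?_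
      have e := h i j
      constructor
      · intro hi
        rw [show f i.succ j.castSucc = (κ i j)⁻¹ • (f i.castSucc j.castSucc + f i.succ j.succ)
          - f i.castSucc j.succ by rw [e, inv_smul_smul₀ (hκ i j)]; abel]
        exact U.sub_mem (U.smul_mem _ (U.add_mem hi (hj _))) (hj _)
      · intro hi
        rw [show f i.castSucc j.castSucc = κ i j • (f i.succ j.castSucc + f i.castSucc j.succ)
          - f i.succ j.succ by rw [← e]; abel]
        exact U.sub_mem (U.smul_mem _ (U.add_mem hi (hj _))) (hj _)
  exact fun i j => key j i

theorem IsMoutard.eq_of_cross (hκ : ∀ i j, κ i j ≠ 0) {g : Fin (a + 1) → Fin (b + 1) → M}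
    (hf : IsMoutard κ f) (hg : IsMoutard κ g) (i₀ : Fin (a + 1)) (j₀ : Fin (b + 1))
    (hr : ∀ i, f i j₀ = g i j₀) (hc : ∀ j, f i₀ j = g i₀ j) : ∀ i j, f i j = g i j := by
  intro i j
  have := (hf.sub hg).mem_of_cross hκ ⊥ i₀ j₀ (fun i => by simp [hr i]) (fun j => by simp [hc j])
    i j
  rw [Submodule.mem_bot] at this
  exact sub_eq_zero.1 this

/-- Comparison of two solutions that are constant on the same column of a face. -/
theorem IsMoutard.one_add_eq (hκ : ∀ i j, κ i j ≠ 0) {f g : Fin (a + 1) → Fin (b + 1) → ℝ}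
    (hf : IsMoutard κ f) (hg : IsMoutard κ g) (k : Fin a) (l : Fin b) (hf₁ : ∀ j, f k.succ j = 1)
    (hg₁ : ∀ j, g k.succ j = 1) (hfl : f k.castSucc l.castSucc = 1)
    (hgl : g k.castSucc l.succ = 1) (j : Fin (b + 1)) :
    1 + g k.castSucc j = κ k l * (1 + f k.castSucc j) := by
  revert j
  have hf' : ∀ j : Fin b, 1 + f k.castSucc j.castSucc = κ k j * (1 + f k.castSucc j.succ) := by
    intro j
    have := hf k j
    rw [hf₁, hf₁, smul_eq_mul] at this
    linarith
  have hg' : ∀ j : Fin b, 1 + g k.castSucc j.castSucc = κ k j * (1 + g k.castSucc j.succ) := by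
    intro j
    have := hg k j
    rw [hg₁, hg₁, smul_eq_mul] at this
    linarith
  -- Both 1 + f and 1 + g satisfy the same first order recursion with invertible factors, so their
  -- ratio is constant along the column. At height l it is κ k l, since 1 + f = 2 there and 1 + g =
  -- 2 one step higher.
  refine forall_fin_of_iff l.castSucc ?_ fun j => ?_
  · rw [hg', hfl, hgl]
  · rw [hf', hg', mul_left_comm (κ k l)]
    exact (mul_right_injective₀ (hκ k j)).eq_iff

end moutard

/-! ### Bilinear forms prescribed on crosses -/

section crosses

variable {a b : ℕ} {V : Type*} [AddCommGroup V] [Module ℝ V] {κ : Fin a → Fin b → ℝ}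
  {p : Fin (a + 1) → Fin (b + 1) → V}

/-- The values of a map on the cross of a vertex. -/
def crossFamily {M : Type*} (f : Fin (a + 1) → Fin (b + 1) → M) (i₀ : Fin (a + 1))
    (j₀ : Fin (b + 1)) : Fin (a + 1) ⊕ Fin b → M :=
  Sum.elim (fun i => f i j₀) (fun j => f i₀ (j₀.succAbove j))

/-- By the Moutard equation any subspace containing a cross contains the whole net. -/
theorem IsMoutard.span_crossFamily (hκ : ∀ i j, κ i j ≠ 0) (hp : IsMoutard κ p)
    (hs : Submodule.span ℝ (Set.range fun x : Fin (a + 1) × Fin (b + 1) => p x.1 x.2) = ⊤)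
    (i₀ : Fin (a + 1)) (j₀ : Fin (b + 1)) :
    ⊤ ≤ Submodule.span ℝ (Set.range (crossFamily p i₀ j₀)) := by
  rw [← hs, Submodule.span_le]
  rintro _ ⟨⟨i, j⟩, rfl⟩
  have hr : ∀ i, p i j₀ ∈ Submodule.span ℝ (Set.range (crossFamily p i₀ j₀)) :=
    fun i => Submodule.subset_span ⟨Sum.inl i, rfl⟩
  refine hp.mem_of_cross hκ _ i₀ j₀ hr (fun j => ?_) i j
  rcases Fin.eq_self_or_eq_succAbove j₀ j with rfl | ⟨j', rfl⟩
  · exact hr _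
  · exact Submodule.subset_span ⟨Sum.inr j', rfl⟩

/-- The vertices on a cross of a net that solves the Moutard equation form a basis, if the vertices
of the net span a space of the maximal dimension. -/
noncomputable def crossBasis (hκ : ∀ i j, κ i j ≠ 0) (hp : IsMoutard κ p)
    (hs : Submodule.span ℝ (Set.range fun x : Fin (a + 1) × Fin (b + 1) => p x.1 x.2) = ⊤)
    (hd : Module.finrank ℝ V = a + b + 1) (i₀ : Fin (a + 1)) (j₀ : Fin (b + 1)) :
    Module.Basis (Fin (a + 1) ⊕ Fin b) ℝ V :=
  basisOfTopLeSpanOfCardEqFinrank (crossFamily p i₀ j₀) (hp.span_crossFamily hκ hs i₀ j₀)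
    (by simp [hd]; omega)

variable (hκ : ∀ i j, κ i j ≠ 0) (hp : IsMoutard κ p)
    (hs : Submodule.span ℝ (Set.range fun x : Fin (a + 1) × Fin (b + 1) => p x.1 x.2) = ⊤)
    (hd : Module.finrank ℝ V = a + b + 1)

theorem crossBasis_apply (i₀ : Fin (a + 1)) (j₀ : Fin (b + 1)) (x : Fin (a + 1) ⊕ Fin b) :
    crossBasis hκ hp hs hd i₀ j₀ x = crossFamily p i₀ j₀ x := by
  simp [crossBasis]

/-- The linear map with prescribed values on the cross of a vertex. -/
noncomputable def crossMap {M : Type*} [AddCommGroup M] [Module ℝ M]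
    (w : Fin (a + 1) → Fin (b + 1) → M) (i₀ : Fin (a + 1)) (j₀ : Fin (b + 1)) : V →ₗ[ℝ] M :=
  (crossBasis hκ hp hs hd i₀ j₀).constr ℝ (crossFamily w i₀ j₀)

theorem crossMap_row {M : Type*} [AddCommGroup M] [Module ℝ M]
    (w : Fin (a + 1) → Fin (b + 1) → M) (i₀ : Fin (a + 1)) (j₀ : Fin (b + 1)) (i : Fin (a + 1)) :
    crossMap hκ hp hs hd w i₀ j₀ (p i j₀) = w i j₀ := by
  have := (crossBasis hκ hp hs hd i₀ j₀).constr_basis ℝ (crossFamily w i₀ j₀) (Sum.inl i)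
  rwa [crossBasis_apply] at this

theorem crossMap_column {M : Type*} [AddCommGroup M] [Module ℝ M]
    (w : Fin (a + 1) → Fin (b + 1) → M) (i₀ : Fin (a + 1)) (j₀ : Fin (b + 1)) (j : Fin (b + 1)) :
    crossMap hκ hp hs hd w i₀ j₀ (p i₀ j) = w i₀ j := by
  rcases Fin.eq_self_or_eq_succAbove j₀ j with rfl | ⟨j, rfl⟩
  · exact crossMap_row hκ hp hs hd w i₀ j i₀
  · have := (crossBasis hκ hp hs hd i₀ j₀).constr_basis ℝ (crossFamily w i₀ j₀) (Sum.inr j)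
    rwa [crossBasis_apply] at this

/-- A bilinear form with `φ (p q) (p x) = w q * w x` whenever `q` and `x` lie in a common row or
column, see `crossForm_row` and `crossForm_column`. -/
noncomputable def crossForm (w : Fin (a + 1) → Fin (b + 1) → ℝ) : LinearMap.BilinForm ℝ V :=
  crossMap hκ hp hs hd (fun i j => w i j • crossMap hκ hp hs hd w i j) 0 0

/-- The cross bases do not depend on t, so in coordinates the value is a polynomial in the weights.
-/
theorem continuous_crossForm {T : Type*} [TopologicalSpace T]
    {w : T → Fin (a + 1) → Fin (b + 1) → ℝ} (hw : ∀ i j, Continuous fun t => w t i j) (x y : V) :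
    Continuous fun t => crossForm hκ hp hs hd (w t) x y := by
  have h₁ : ∀ i₀ j₀ y, Continuous fun t => crossMap hκ hp hs hd (w t) i₀ j₀ y := by
    intro i₀ j₀ y
    simp only [crossMap, Module.Basis.constr_apply_fintype, smul_eq_mul]
    refine continuous_finsetSum _ fun k _ => continuous_const.mul ?_
    rcases k with i | j
    · exact hw i j₀
    · exact hw i₀ _
  have h₂ : ∀ t, crossForm hκ hp hs hd (w t) x y = ∑ k, (crossBasis hκ hp hs hd 0 0).equivFun x k *
      crossFamily (fun i j => w t i j * crossMap hκ hp hs hd (w t) i j y) 0 0 k := by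
    intro t
    rw [crossForm, crossMap, Module.Basis.constr_apply_fintype, LinearMap.sum_apply]
    refine Finset.sum_congr rfl fun k _ => ?_
    rcases k with i | j <;> rfl
  simp only [h₂]
  refine continuous_finsetSum _ fun k _ => ?_
  rcases k with i | j
  · exact continuous_const.mul ((hw i 0).mul (h₁ i 0 y))
  · exact continuous_const.mul ((hw 0 _).mul (h₁ 0 _ y))

variable {w : Fin (a + 1) → Fin (b + 1) → ℝ} (hw : ∀ i j, w i j ≠ 0)
  {κ' : Fin a → Fin b → ℝ} (hκ' : ∀ i j, κ' i j ≠ 0)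
  (hp' : IsMoutard κ' fun i j => (w i j)⁻¹ • p i j)
include hw hκ' hp'

/-- On the rescaled vertices each functional is one on its own cross. The two sides of the equation
at a face are functionals, so they need to be compared only on the cross of one corner of that face.
On the row or column through this corner two of the four functionals are one, and the remaining two
are related by `IsMoutard.one_add_eq`. -/
theorem isMoutard_crossMap : IsMoutard κ' fun i j => crossMap hκ hp hs hd w i j := by
  intro k l
  simp only
  have hone_row : ∀ i₀ j₀ i, crossMap hκ hp hs hd w i₀ j₀ ((w i j₀)⁻¹ • p i j₀) = 1 := by
    intro i₀ j₀ i
    rw [map_smul, crossMap_row, smul_eq_mul, inv_mul_cancel₀ (hw _ _)]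
  have hone_col : ∀ i₀ j₀ j, crossMap hκ hp hs hd w i₀ j₀ ((w i₀ j)⁻¹ • p i₀ j) = 1 := by
    intro i₀ j₀ j
    rw [map_smul, crossMap_column, smul_eq_mul, inv_mul_cancel₀ (hw _ _)]
  set F := fun i j => crossMap hκ hp hs hd w i j with hF
  have hm : ∀ i j, IsMoutard κ' fun i' j' => F i j ((w i' j')⁻¹ • p i' j') := fun i j => hp'.map _
  set L := F k.castSucc l.castSucc + F k.succ l.succ with hL
  set R := κ' k l • (F k.succ l.castSucc + F k.castSucc l.succ) with hR
  have key : ∀ i j, L ((w i j)⁻¹ • p i j) = R ((w i j)⁻¹ • p i j) := by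
    refine IsMoutard.eq_of_cross hκ' (hp'.map L) (hp'.map R) k.castSucc l.castSucc ?_ ?_
    · intro i
      have := IsMoutard.one_add_eq (fun i j => hκ' j i) (hm k.castSucc l.succ).swap
        (hm k.succ l.succ).swap l k (hone_row _ _) (hone_row _ _) (hone_col _ _ _)
        (hone_col _ _ _) i
      have e₁ := hone_row k.castSucc l.castSucc i
      have e₂ := hone_row k.succ l.castSucc i
      simp only [hL, hR, LinearMap.add_apply, LinearMap.smul_apply, smul_eq_mul, hF] at this ⊢
      rw [e₁, e₂, this]
    · intro j
      have := IsMoutard.one_add_eq hκ' (hm k.succ l.castSucc) (hm k.succ l.succ) k l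
        (hone_col _ _) (hone_col _ _) (hone_row _ _ _) (hone_row _ _ _) j
      have e₁ := hone_col k.castSucc l.castSucc j
      have e₂ := hone_col k.castSucc l.succ j
      simp only [hL, hR, LinearMap.add_apply, LinearMap.smul_apply, smul_eq_mul, hF] at this ⊢
      rw [e₁, e₂, this, add_comm (1 : ℝ)]
  refine LinearMap.ext_on_range hs fun x => ?_
  have := key x.1 x.2
  rw [map_smul, map_smul] at this
  exact smul_right_injective _ (inv_ne_zero (hw _ _)) this

/-- The definition fixes the form only on the cross of the corner (0, 0). The rescaled vertices and
the functionals solve the same Moutard equation, so the agreement spreads over the grid. -/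
theorem crossForm_apply (i : Fin (a + 1)) (j : Fin (b + 1)) :
    crossForm hκ hp hs hd w (p i j) = w i j • crossMap hκ hp hs hd w i j := by
  have h := isMoutard_crossMap hκ hp hs hd hw hκ' hp'
  have key : ∀ i j, crossForm hκ hp hs hd w ((w i j)⁻¹ • p i j) = crossMap hκ hp hs hd w i j := by
    refine IsMoutard.eq_of_cross hκ' (hp'.map _) h 0 0 (fun i => ?_) (fun j => ?_)
    · rw [map_smul, crossForm, crossMap_row, inv_smul_smul₀ (hw _ _)]
    · rw [map_smul, crossForm, crossMap_column, inv_smul_smul₀ (hw _ _)]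
  rw [← key, map_smul, smul_inv_smul₀ (hw _ _)]

theorem crossForm_row (i i' : Fin (a + 1)) (j : Fin (b + 1)) :
    crossForm hκ hp hs hd w (p i j) (p i' j) = w i j * w i' j := by
  rw [crossForm_apply hκ hp hs hd hw hκ' hp', LinearMap.smul_apply, crossMap_row, smul_eq_mul]

theorem crossForm_column (i : Fin (a + 1)) (j j' : Fin (b + 1)) :
    crossForm hκ hp hs hd w (p i j) (p i j') = w i j * w i j' := by
  rw [crossForm_apply hκ hp hs hd hw hκ' hp', LinearMap.smul_apply, crossMap_column, smul_eq_mul]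

/-- For a fixed vertex, inserting it in the first or the second slot gives functionals that agree on
its cross, hence on the whole net, which spans. -/
theorem isSymm_crossForm : (crossForm hκ hp hs hd w).IsSymm := by
  have h : (crossForm hκ hp hs hd w).flip = crossForm hκ hp hs hd w := by
    refine LinearMap.ext_on_range hs fun x => ?_
    refine LinearMap.ext_on_range hs fun y => ?_
    refine IsMoutard.eq_of_cross hκ (hp.map ((crossForm hκ hp hs hd w).flip (p x.1 x.2)))
      (hp.map (crossForm hκ hp hs hd w (p x.1 x.2))) x.1 x.2 (fun i => ?_) (fun j => ?_) y.1 y.2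
    · rw [LinearMap.BilinForm.flip_apply, crossForm_row hκ hp hs hd hw hκ' hp',
        crossForm_row hκ hp hs hd hw hκ' hp', mul_comm]
    · rw [LinearMap.BilinForm.flip_apply, crossForm_column hκ hp hs hd hw hκ' hp',
        crossForm_column hκ hp hs hd hw hκ' hp', mul_comm]
  exact ⟨fun x y => by conv_lhs => rw [← h, LinearMap.BilinForm.flip_apply]⟩

end crosses

/-! ### Double lines and the Laplace points -/

section doubleLine

variable {n : ℕ} {X Y X' Y' S : RP n} {A B A' B' : Fin (n + 1) → ℝ} {W M : Sub n}
  {φ : Form n} {C : Set (RP n)}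

theorem le_of_points_subset (h : points M ⊆ points W) : M ≤ W := by
  intro x hx
  by_cases h0 : x = 0
  · rw [h0]; exact W.zero_mem
  · have hr := represents_mk h0
    exact hr.mem_points.1 (h (hr.mem_points.2 hx))

theorem two_le_finrank_span_pair
    (h : Module.finrank ℝ (Submodule.span ℝ {A, B, A'} : Sub n) = 3) :
    2 ≤ Module.finrank ℝ (Submodule.span ℝ {A, B} : Sub n) := by
  have e : ({A, B, A'} : Set (Fin (n + 1) → ℝ)) = {A, B} ∪ {A'} := by
    rw [Set.insert_union, Set.singleton_union]
  rw [e, Submodule.span_union] at h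
  have h1 := Submodule.finrank_add_le_finrank_add_finrank (Submodule.span ℝ {A, B} : Sub n)
    (Submodule.span ℝ {A'})
  have h2 : Module.finrank ℝ (ℝ ∙ A') ≤ 1 := (finrank_span_le_card (R := ℝ) {A'}).trans (by simp)
  omega

/-- An isotropic line in a plane contains the touching points of the lines of the plane. -/
theorem sub_mem_of_isotropic (hφ : φ.IsSymm) (hW : Module.finrank ℝ W = 3)
    (hM : Module.finrank ℝ M = 2) (hMW : M ≤ W) (h0 : ∀ x ∈ M, φ x x = 0)
    (hL : 2 ≤ Module.finrank ℝ (Submodule.span ℝ {A, B} : Sub n)) (hA : A ∈ W) (hB : B ∈ W)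
    (hAA : φ A A = 1) (hAB : φ A B = 1) (hBB : φ B B = 1) : A - B ∈ M := by
  have hLW : Submodule.span ℝ {A, B} ≤ W := by
    rw [Submodule.span_le]
    rintro x (rfl | rfl) <;> assumption
  -- Two lines in a plane meet. On the span of A and B the form is (u + v) ^ 2, so a common
  -- isotropic vector is a multiple of A - B.
  have h1 := Submodule.finrank_sup_add_finrank_inf_eq M (Submodule.span ℝ {A, B})
  have h2 := Submodule.finrank_mono (sup_le hMW hLW)
  have h3 : M ⊓ Submodule.span ℝ {A, B} ≠ ⊥ := by
    intro h
    rw [h, finrank_bot] at h1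
    omega
  obtain ⟨x, ⟨hxM, hxL⟩, hx⟩ := Submodule.exists_mem_ne_zero_of_ne_bot h3
  obtain ⟨u, v, rfl⟩ := Submodule.mem_span_pair.1 hxL
  have h4 := h0 _ hxM
  simp only [map_add, LinearMap.add_apply, map_smul, LinearMap.smul_apply, smul_eq_mul,
    hφ.eq B A, hAA, hAB, hBB] at h4
  have h5 : (u + v) ^ 2 = 0 := by linear_combination h4
  have h6 : v = -u := by linarith [pow_eq_zero_iff two_ne_zero |>.1 h5]
  subst h6
  have hu : u ≠ 0 := by rintro rfl; simp at hx
  have : A - B = u⁻¹ • (u • A + (-u) • B) := by match_scalars <;> field_simp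
  rw [this]
  exact M.smul_mem _ hxM

/-- If a form takes the value one on the edges of a quad and defines a double line, then the double
line contains the Laplace points. -/
theorem laplace_le (hφ : φ.IsSymm) (hq : IsQuad A B A' B') {κ : ℝ}
    (hm : A + B' = κ • (B + A'))
    (hW : Module.finrank ℝ W = 3) (hA : A ∈ W) (hB : B ∈ W) (hA' : A' ∈ W)
    (hM : Module.finrank ℝ M = 2) (hMW : M ≤ W) (h0 : ∀ x ∈ M, φ x x = 0)
    (hAA : φ A A = 1) (hAB : φ A B = 1) (hBB : φ B B = 1) (hAA' : φ A A' = 1)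
    (hA'A' : φ A' A' = 1) (hBB' : φ B B' = 1) :
    Submodule.span ℝ {A, B} ⊓ Submodule.span ℝ {A', B'} ≤ M ∧
      Submodule.span ℝ {A, A'} ⊓ Submodule.span ℝ {B, B'} ≤ M := by
  have hq' : Module.finrank ℝ (Submodule.span ℝ {A, A', B} : Sub n) = 3 := by
    rw [show ({A, A', B} : Set (Fin (n + 1) → ℝ)) = {A, B, A'} by rw [Set.pair_comm]]
    exact hq.finrank_eq
  have m₁ := sub_mem_of_isotropic hφ hW hM hMW h0 (two_le_finrank_span_pair hq.finrank_eq) hA hB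
    hAA hAB hBB
  have m₂ := sub_mem_of_isotropic hφ hW hM hMW h0 (two_le_finrank_span_pair hq') hA hA'
    hAA hAA' hA'A'
  -- The double line contains A - B and A - A', hence also their difference. Its isotropy gives φ B
  -- A' = 1 and then κ = 1. Now A - B = A' - B' and A - A' = B - B', so these touching points are
  -- the Laplace points.
  have hBA' : φ B A' = 1 := by
    have e := h0 _ (M.sub_mem m₁ m₂)
    simp only [map_sub, LinearMap.sub_apply, hφ.eq B A, hφ.eq A' A, hφ.eq A' B, hAA, hAB, hAA',
      hBB, hA'A'] at e
    linarith
  have eB' : B' = κ • (B + A') - A := by rw [← hm]; abel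
  have hκ : κ = 1 := by
    rw [eB'] at hBB'
    simp only [map_sub, map_smul, map_add, smul_eq_mul, hBB, hBA', hφ.eq B A, hAB] at hBB'
    linarith
  subst hκ
  constructor
  · rintro x ⟨h₁, h₂⟩
    obtain ⟨u, v, rfl⟩ := Submodule.mem_span_pair.1 h₁
    obtain ⟨s, t, e⟩ := Submodule.mem_span_pair.1 h₂
    obtain ⟨z₁, z₂, -⟩ := triple_independent hq.finrank_eq (a := u + t) (b := v - t)
      (c := -(s + t)) (by
        rw [eB'] at e
        rw [← sub_eq_zero_of_eq e.symm]
        module)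
    rw [show u • A + v • B = u • (A - B) by
      rw [show v = -u by linarith]; module]
    exact M.smul_mem _ m₁
  · rintro x ⟨h₁, h₂⟩
    obtain ⟨u, v, rfl⟩ := Submodule.mem_span_pair.1 h₁
    obtain ⟨s, t, e⟩ := Submodule.mem_span_pair.1 h₂
    obtain ⟨z₁, -, z₂⟩ := triple_independent hq.finrank_eq (a := u + t) (b := -(s + t))
      (c := v - t) (by
        rw [eB'] at e
        rw [← sub_eq_zero_of_eq e.symm]
        module)
    rw [show u • A + v • A' = u • (A - A') by
      rw [show v = -u by linarith]; module]
    exact M.smul_mem _ m₂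

theorem touchesAt_of_apply_eq_one (hA : Represents A X) (hB : Represents B Y)
    (hS : Represents (A - B) S) (hφ : Defines φ W C) (hAA : φ A A = 1) (hAB : φ A B = 1)
    (hBB : φ B B = 1) : TouchesAt W C (join₂ X Y) S := by
  refine ⟨φ, hφ, ?_, ?_⟩
  · rw [hS.mem_points, hA.join₂ hB]
    exact Submodule.mem_span_pair.2 ⟨1, -1, by module⟩
  · intro y hy
    rw [hA.join₂ hB] at hy
    obtain ⟨u, v, rfl⟩ := Submodule.mem_span_pair.1 hy
    obtain ⟨c, -, e⟩ := hS.exists_smul (represents_rep S)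
    simp [e, hφ.1.eq B A, hAA, hAB, hBB]

theorem TouchesAt.apply_eq (h : TouchesAt W C (join₂ X Y) S) (hL : join₂ X Y ≤ W)
    (hφ : Defines φ W C) (hA : Represents A X) (hB : Represents B Y)
    (hS : Represents (A - B) S) : φ A B = φ A A ∧ φ B B = φ A A := by
  have hk := h.apply_eq_zero hL hφ hS
  rw [hA.join₂ hB] at hk
  have hkA := hk A (Submodule.subset_span (by simp))
  have hkB := hk B (Submodule.subset_span (by simp))
  simp only [map_sub, LinearMap.sub_apply, hφ.1.eq B A] at hkA hkB
  constructor <;> linarith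

end doubleLine

/-! ### Inscribed quadrics and cross forms -/

section inscribed

variable {a b n : ℕ} {P : Net a b n}

/-- A form that takes the value one on each pair of vertices in a common row or column. -/
structure IsCrossForm (φ : Form n) (p : Fin (a + 1) → Fin (b + 1) → Fin (n + 1) → ℝ) : Prop where
  isSymm : φ.IsSymm
  row : ∀ i i' j, φ (p i j) (p i' j) = 1
  column : ∀ i j j', φ (p i j) (p i j') = 1

variable {p : Fin (a + 1) → Fin (b + 1) → Fin (n + 1) → ℝ} {κ : Fin a → Fin b → ℝ} {φ : Form n}

theorem IsCrossForm.ne_zero (h : IsCrossForm φ p) : φ ≠ 0 := by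
  rintro rfl
  simpa using h.row 0 0 0

theorem mem_facePlane (hp : ∀ i j, Represents (p i j) (P i j)) (i : Fin a) (j : Fin b) :
    p i.castSucc j.castSucc ∈ facePlane P i j ∧ p i.succ j.castSucc ∈ facePlane P i j ∧
      p i.castSucc j.succ ∈ facePlane P i j := by
  rw [facePlane, (hp _ _).join₃ (hp _ _) (hp _ _)]
  exact ⟨Submodule.subset_span (by simp), Submodule.subset_span (by simp),
    Submodule.subset_span (by simp)⟩

theorem IsCrossForm.defines (h : IsCrossForm φ p) (hp : ∀ i j, Represents (p i j) (P i j))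
    (i : Fin a) (j : Fin b) :
    Defines φ (facePlane P i j) (zeroSet φ ∩ points (facePlane P i j)) :=
  ⟨h.isSymm, ⟨_, (mem_facePlane hp i j).1, _, (mem_facePlane hp i j).1, by simp [h.row]⟩, rfl⟩

section existence

variable (hQ : IsQNet P) (hN : IsNondegenerate P) (hp : ∀ i j, Represents (p i j) (P i j))
include hQ hN hp

theorem IsCrossForm.isInscribedConic (h : IsCrossForm φ p) (hm : IsMoutard κ p)
    (i : Fin a) (j : Fin b) :
    IsInscribedConic (P i.castSucc j.castSucc) (P i.succ j.castSucc) (P i.castSucc j.succ)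
      (P i.succ j.succ) (zeroSet φ ∩ points (facePlane P i j)) := by
  have hd := h.defines hp i j
  have hq := hN.isQuad hQ i j (hp _ _) (hp _ _) (hp _ _) (hp _ _)
  have hne₁ : ∀ i j, p (Fin.castSucc i) j - p i.succ j ≠ 0 := fun i j e =>
    hN.horizontal i j ((hp _ _).unique (by rw [sub_eq_zero.1 e]; exact hp _ _))
  have hne₂ : ∀ i j, p i (Fin.castSucc j) - p i j.succ ≠ 0 := fun i j e =>
    hN.vertical i j ((hp _ _).unique (by rw [sub_eq_zero.1 e]; exact hp _ _))
  refine ⟨⟨φ, hd⟩, ?_, ?_, ?_, ?_, ?_⟩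
  · exact ⟨_, touchesAt_of_apply_eq_one (hp _ _) (hp _ _) (represents_mk (hne₁ _ _)) hd
      (h.row _ _ _) (h.row _ _ _) (h.row _ _ _)⟩
  · exact ⟨_, touchesAt_of_apply_eq_one (hp _ _) (hp _ _) (represents_mk (hne₁ _ _)) hd
      (h.row _ _ _) (h.row _ _ _) (h.row _ _ _)⟩
  · exact ⟨_, touchesAt_of_apply_eq_one (hp _ _) (hp _ _) (represents_mk (hne₂ _ _)) hd
      (h.row _ _ _) (h.column _ _ _) (h.row _ _ _)⟩
  · exact ⟨_, touchesAt_of_apply_eq_one (hp _ _) (hp _ _) (represents_mk (hne₂ _ _)) hd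
      (h.row _ _ _) (h.column _ _ _) (h.row _ _ _)⟩
  · intro M hM hC
    obtain ⟨mA, mB, mA'⟩ := mem_facePlane hp i j
    rw [(hp _ _).join₂ (hp _ _), (hp _ _).join₂ (hp _ _), (hp _ _).join₂ (hp _ _),
      (hp _ _).join₂ (hp _ _)]
    exact laplace_le h.isSymm hq (hm i j) (hN.triple₁ i j) mA mB mA' hM
      (le_of_points_subset (hC ▸ Set.inter_subset_right))
      (points_subset_zeroSet_iff.1 (hC ▸ Set.inter_subset_left))
      (h.row _ _ _) (h.row _ _ _) (h.row _ _ _) (h.column _ _ _) (h.row _ _ _) (h.column _ _ _)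

theorem IsCrossForm.exists_isAdapted (h : IsCrossForm φ p) (hm : IsMoutard κ p) :
    ∃ 𝒞 : TouchingConics P, 𝒞.IsAdapted p := by
  have hne₁ : ∀ i j, p (Fin.castSucc i) j - p i.succ j ≠ 0 := fun i j e =>
    hN.horizontal i j ((hp _ _).unique (by rw [sub_eq_zero.1 e]; exact hp _ _))
  have hne₂ : ∀ i j, p i (Fin.castSucc j) - p i j.succ ≠ 0 := fun i j e =>
    hN.vertical i j ((hp _ _).unique (by rw [sub_eq_zero.1 e]; exact hp _ _))
  exact ⟨{
    conic := fun i j => zeroSet φ ∩ points (facePlane P i j)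
    S := fun i j => Projectivization.mk ℝ _ (hne₁ i j)
    T := fun i j => Projectivization.mk ℝ _ (hne₂ i j)
    inscribed := h.isInscribedConic hQ hN hp hm
    touches_bottom := fun i j => touchesAt_of_apply_eq_one (hp _ _) (hp _ _) (represents_mk _)
      (h.defines hp i j) (h.row _ _ _) (h.row _ _ _) (h.row _ _ _)
    touches_top := fun i j => touchesAt_of_apply_eq_one (hp _ _) (hp _ _) (represents_mk _)
      (h.defines hp i j) (h.row _ _ _) (h.row _ _ _) (h.row _ _ _)
    touches_left := fun i j => touchesAt_of_apply_eq_one (hp _ _) (hp _ _) (represents_mk _)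
      (h.defines hp i j) (h.row _ _ _) (h.column _ _ _) (h.row _ _ _)
    touches_right := fun i j => touchesAt_of_apply_eq_one (hp _ _) (hp _ _) (represents_mk _)
      (h.defines hp i j) (h.row _ _ _) (h.column _ _ _) (h.row _ _ _) },
    ⟨hp, fun i j => represents_mk _, fun i j => represents_mk _⟩⟩

end existence

/-- The differences are orthogonal to every vector q i and lie in the span of these vectors, so they
span a totally isotropic space. -/
theorem isotropic_of_differences {m : ℕ} {q : Fin (m + 1) → Fin (n + 1) → ℝ} {U : Fin m → RP n}
    (hU : ∀ i, Represents (q i.castSucc - q i.succ) (U i)) (hφ : ∀ i i', φ (q i) (q i') = 1) :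
    ∀ x ∈ ⨆ i, (U i).submodule, φ x x = 0 := by
  have h₁ : ∀ i, ⨆ i, (U i).submodule ≤ LinearMap.ker (φ (q i)) := by
    intro i
    refine iSup_le fun k => ?_
    rw [hU k, Submodule.span_singleton_le_iff_mem]
    simp [hφ]
  have h₂ : ⨆ i, (U i).submodule ≤ Submodule.span ℝ (Set.range q) := by
    refine iSup_le fun k => ?_
    rw [hU k, Submodule.span_singleton_le_iff_mem]
    exact Submodule.sub_mem _ (Submodule.subset_span ⟨_, rfl⟩) (Submodule.subset_span ⟨_, rfl⟩)
  intro x hx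
  have h₃ : Submodule.span ℝ (Set.range q) ≤ LinearMap.ker (φ.flip x) := by
    rw [Submodule.span_le]
    rintro _ ⟨i, rfl⟩
    simpa [LinearMap.BilinForm.flip_apply] using h₁ i hx
  simpa [LinearMap.BilinForm.flip_apply] using h₃ (h₂ hx)

theorem sub_mem_iSup_differences {m : ℕ} {q : Fin (m + 1) → Fin (n + 1) → ℝ} {U : Fin m → RP n}
    (hU : ∀ i, Represents (q i.castSucc - q i.succ) (U i)) (i i' : Fin (m + 1)) :
    q i - q i' ∈ ⨆ i, (U i).submodule := by
  have h₀ : ∀ i, q 0 - q i ∈ ⨆ i, (U i).submodule := by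
    intro i
    induction i using Fin.induction with
    | zero => simp
    | succ i ih =>
      have : q i.castSucc - q i.succ ∈ ⨆ i, (U i).submodule := by
        refine Submodule.mem_iSup_of_mem i ?_
        rw [hU i]
        exact Submodule.mem_span_singleton_self _
      simpa using add_mem ih this
  simpa using sub_mem (h₀ i') (h₀ i)

variable {𝒞 𝒞' : TouchingConics P} (hQ : IsQNet P) (hN : IsNondegenerate P)
include hQ hN

theorem TouchingConics.IsAdapted.apply_eq (h : 𝒞.IsAdapted p) {i : Fin a} {j : Fin b}
    (hφ : Defines φ (facePlane P i j) (𝒞.conic i j)) :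
    (φ (p i.castSucc j.castSucc) (p i.succ j.castSucc) =
        φ (p i.castSucc j.castSucc) (p i.castSucc j.castSucc) ∧
      φ (p i.succ j.castSucc) (p i.succ j.castSucc) =
        φ (p i.castSucc j.castSucc) (p i.castSucc j.castSucc)) ∧
    (φ (p i.castSucc j.succ) (p i.succ j.succ) =
        φ (p i.castSucc j.succ) (p i.castSucc j.succ) ∧
      φ (p i.succ j.succ) (p i.succ j.succ) =
        φ (p i.castSucc j.succ) (p i.castSucc j.succ)) ∧
    (φ (p i.castSucc j.castSucc) (p i.castSucc j.succ) =
        φ (p i.castSucc j.castSucc) (p i.castSucc j.castSucc) ∧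
      φ (p i.castSucc j.succ) (p i.castSucc j.succ) =
        φ (p i.castSucc j.castSucc) (p i.castSucc j.castSucc)) ∧
    (φ (p i.succ j.castSucc) (p i.succ j.succ) =
        φ (p i.succ j.castSucc) (p i.succ j.castSucc) ∧
      φ (p i.succ j.succ) (p i.succ j.succ) =
        φ (p i.succ j.castSucc) (p i.succ j.castSucc)) := by
  have hp := h.represents
  have hq := hN.isQuad hQ i j (hp _ _) (hp _ _) (hp _ _) (hp _ _)
  obtain ⟨l₁, l₂, l₃, l₄⟩ := hq.join₂_le (hp _ _) (hp _ _) (hp _ _) (hp _ _)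
  exact ⟨(𝒞.touches_bottom i j).apply_eq l₁ hφ (hp _ _) (hp _ _) (h.represents_S _ _),
    (𝒞.touches_top i j).apply_eq l₂ hφ (hp _ _) (hp _ _) (h.represents_S _ _),
    (𝒞.touches_left i j).apply_eq l₃ hφ (hp _ _) (hp _ _) (h.represents_T _ _),
    (𝒞.touches_right i j).apply_eq l₄ hφ (hp _ _) (hp _ _) (h.represents_T _ _)⟩

/-- In adapted coordinates a form ψ of the conic is constant along the edges. Its one remaining Gram
entry, between the two neighbours of the first vertex, follows from the Moutard equation because κ ≠
0. Hence ψ is a multiple of φ on the plane. -/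
theorem TouchingConics.IsAdapted.conic_eq (h : 𝒞.IsAdapted p) (hφ : IsCrossForm φ p)
    (i : Fin a) (j : Fin b) : 𝒞.conic i j = zeroSet φ ∩ points (facePlane P i j) := by
  obtain ⟨κ, hκ, hm⟩ := h.moutard hQ hN
  obtain ⟨ψ, hψ⟩ := (𝒞.inscribed i j).isConic
  obtain ⟨⟨g₁, g₂⟩, -, ⟨g₃, g₄⟩, g₅, -⟩ := h.apply_eq hQ hN hψ
  have hp := h.represents
  have hs := hψ.1
  have hs' := hφ.isSymm
  have e : p i.succ j.succ = κ i j • (p i.succ j.castSucc + p i.castSucc j.succ)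
      - p i.castSucc j.castSucc := by rw [← hm i j]; abel
  have f₁ : κ i j * ψ (p i.succ j.castSucc) (p i.castSucc j.succ) =
      (2 - κ i j) * ψ (p i.castSucc j.castSucc) (p i.castSucc j.castSucc) := by
    rw [e] at g₅
    simp only [map_sub, map_smul, map_add, smul_eq_mul, g₂,
      hs.eq (p i.succ j.castSucc) (p i.castSucc j.castSucc), g₁] at g₅
    linarith
  have f₂ : κ i j * φ (p i.succ j.castSucc) (p i.castSucc j.succ) = 2 - κ i j := by
    have g := hφ.column i.succ j.castSucc j.succ
    rw [e] at g
    simp only [map_sub, map_smul, map_add, smul_eq_mul, hφ.row] at g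
    linarith
  have f₃ : ψ (p i.succ j.castSucc) (p i.castSucc j.succ) =
      ψ (p i.castSucc j.castSucc) (p i.castSucc j.castSucc) *
        φ (p i.succ j.castSucc) (p i.castSucc j.succ) := by
    apply mul_left_cancel₀ (hκ i j)
    rw [f₁, mul_left_comm, f₂, mul_comm]
  have key : ∀ x ∈ facePlane P i j, ψ x x =
      ψ (p i.castSucc j.castSucc) (p i.castSucc j.castSucc) * φ x x := by
    intro x hx
    rw [facePlane, (hp _ _).join₃ (hp _ _) (hp _ _)] at hx
    obtain ⟨u, v, w, rfl⟩ := Submodule.mem_span_triple.1 hx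
    simp only [map_add, LinearMap.add_apply, map_smul, LinearMap.smul_apply, smul_eq_mul,
      hs.eq (p i.succ j.castSucc) (p i.castSucc j.castSucc),
      hs.eq (p i.castSucc j.succ) (p i.castSucc j.castSucc),
      hs.eq (p i.castSucc j.succ) (p i.succ j.castSucc), g₁, g₂, g₃, g₄, f₃,
      hs'.eq (p i.castSucc j.succ) (p i.succ j.castSucc), hφ.row, hφ.column]
    ring
  have hc : ψ (p i.castSucc j.castSucc) (p i.castSucc j.castSucc) ≠ 0 := by
    obtain ⟨x, hx, hx0⟩ := exists_ne_zero_of_isSymm hψ.1 hψ.2.1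
    intro h0
    rw [facePlane] at key
    rw [key x hx, h0, zero_mul] at hx0
    exact hx0 rfl
  rw [hψ.2.2]
  refine zeroSet_inter_points_eq_iff.2 fun x hx => ?_
  rw [key x hx]
  simp [hc]

theorem TouchingConics.IsAdapted.unique (h : 𝒞.IsAdapted p) (h' : 𝒞'.IsAdapted p)
    (hφ : IsCrossForm φ p) : 𝒞 = 𝒞' := by
  ext1
  · funext i j
    rw [h.conic_eq hQ hN hφ, h'.conic_eq hQ hN hφ]
  · funext i j
    exact (h.represents_S i j).unique (h'.represents_S i j)
  · funext i j
    exact (h.represents_T i j).unique (h'.represents_T i j)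

theorem TouchingConics.IsAdapted.isInscribedQuadric (h : 𝒞.IsAdapted p) (hφ : IsCrossForm φ p) :
    IsInscribedQuadric 𝒞 (zeroSet φ) where
  isQuadric := ⟨φ, hφ.isSymm, hφ.ne_zero, rfl⟩
  conic_eq := h.conic_eq hQ hN hφ
  vSpace_subset i := points_subset_zeroSet_iff.2
    (isotropic_of_differences (q := p i) (h.represents_T i) (hφ.column i))
  hSpace_subset j := points_subset_zeroSet_iff.2
    (isotropic_of_differences (q := fun i => p i j) (fun i => h.represents_S i j) (fun i i' => hφ.row i i' j))

/-- Tangency on the faces makes the diagonal values of a competing form ψ equal to one constant c.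
Isotropy of the joined touching points polarises this to all pairs in a common row or column, and
Moutard propagation yields ψ = c • φ. -/
theorem TouchingConics.IsAdapted.eq_zeroSet (ha : 1 ≤ a) (hb : 1 ≤ b) (h : 𝒞.IsAdapted p)
    (hφ : IsCrossForm φ p)
    (hs : Submodule.span ℝ (Set.range fun x : Fin (a + 1) × Fin (b + 1) => p x.1 x.2) = ⊤)
    {Q : Set (RP n)} (hC : IsInscribedQuadric 𝒞 Q) : Q = zeroSet φ := by
  obtain ⟨κ, hκ, hm⟩ := h.moutard hQ hN
  obtain ⟨⟨ψ, hψ, hψ0, rfl⟩, hconic, hv, hh⟩ := hC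
  have hd : ∀ i j, Defines ψ (facePlane P i j) (𝒞.conic i j) := by
    intro i j
    refine ⟨hψ, ?_, hconic i j⟩
    -- If ψ vanished on the plane, the conic would be the whole plane, but it has a non-trivial
    -- defining form χ.
    by_contra! h0
    obtain ⟨χ, hχ⟩ := (𝒞.inscribed i j).isConic
    obtain ⟨x, hx, hx0⟩ := exists_ne_zero_of_isSymm hχ.1 hχ.2.1
    exact hx0 ((zeroSet_inter_points_eq_iff.1 (hχ.2.2.symm.trans (hconic i j)) x hx).2
      (h0 x hx x hx))
  have hg := fun i j => h.apply_eq hQ hN (hd i j)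
  have hH : ∀ (i : Fin a) (j : Fin (b + 1)), ψ (p i.succ j) (p i.succ j) =
      ψ (p i.castSucc j) (p i.castSucc j) := fun i =>
    forall_fin_of_castSucc_of_succ hb (fun j => (hg i j).1.2) (fun j => (hg i j).2.1.2)
  have hV : ∀ (j : Fin b) (i : Fin (a + 1)), ψ (p i j.succ) (p i j.succ) =
      ψ (p i j.castSucc) (p i j.castSucc) := fun j =>
    forall_fin_of_castSucc_of_succ ha (fun i => (hg i j).2.2.1.2) (fun i => (hg i j).2.2.2.2)
  set c := ψ (p 0 0) (p 0 0) with hc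
  have hdiag : ∀ i j, ψ (p i j) (p i j) = c := by
    intro i j
    induction j using Fin.induction with
    | zero =>
      induction i using Fin.induction with
      | zero => rfl
      | succ i ih => rw [hH, ih]
    | succ j ih => rw [hV, ih]
  have polar : ∀ x y, ψ x x = c → ψ y y = c → ψ (x - y) (x - y) = 0 → ψ x y = c := by
    intro x y h₁ h₂ h₃
    simp only [map_sub, LinearMap.sub_apply, h₁, h₂, hψ.eq y x] at h₃
    linarith
  have hrow : ∀ i i' j, ψ (p i j) (p i' j) = c := fun i i' j =>
    polar _ _ (hdiag _ _) (hdiag _ _) (points_subset_zeroSet_iff.1 (hh j) _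
      (sub_mem_iSup_differences (q := fun i => p i j) (fun i => h.represents_S i j) i i'))
  have hcol : ∀ i j j', ψ (p i j) (p i j') = c := fun i j j' =>
    polar _ _ (hdiag _ _) (hdiag _ _) (points_subset_zeroSet_iff.1 (hv i) _
      (sub_mem_iSup_differences (q := p i) (h.represents_T i) j j'))
  have key : ψ = c • φ := by
    refine LinearMap.ext_on_range hs fun x => ?_
    refine LinearMap.ext_on_range hs fun y => ?_
    refine IsMoutard.eq_of_cross hκ (hm.map (ψ (p x.1 x.2))) (hm.map ((c • φ) (p x.1 x.2)))
      x.1 x.2 (fun i => ?_) (fun j => ?_) y.1 y.2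
    · simp [hrow, hφ.row]
    · simp [hcol, hφ.column]
  have hc0 : c ≠ 0 := by
    intro h0
    rw [h0, zero_smul] at key
    exact hψ0 key
  ext X
  simp [zeroSet, key, hc0]

end inscribed

/-! ### Chessboard weights -/

section chess

variable {a b : ℕ}

/-- The weights `1` and `t` on the black and white vertices of the grid. -/
noncomputable def chess (t : ℝ) (i : Fin (a + 1)) (j : Fin (b + 1)) : ℝ :=
  if Even (i.val + j.val) then 1 else t

theorem chess_ne_zero {t : ℝ} (ht : t ≠ 0) (i : Fin (a + 1)) (j : Fin (b + 1)) :
    chess t i j ≠ 0 := by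
  unfold chess; split_ifs <;> simp [ht]

theorem chess_zero_zero (t : ℝ) : chess t (0 : Fin (a + 1)) (0 : Fin (b + 1)) = 1 := by
  simp [chess]

theorem chess_horizontal (t : ℝ) (i : Fin a) (j : Fin (b + 1)) :
    chess t i.castSucc j * chess t i.succ j = t := by
  have : Even (i.val + 1 + j.val) ↔ ¬ Even (i.val + j.val) := by
    rw [add_right_comm, Nat.even_add_one]
  simp only [chess, Fin.val_castSucc, Fin.val_succ, this]
  split_ifs <;> simp

theorem chess_vertical (t : ℝ) (i : Fin (a + 1)) (j : Fin b) :
    chess t i j.castSucc * chess t i j.succ = t := by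
  have : Even (i.val + (j.val + 1)) ↔ ¬ Even (i.val + j.val) := by
    rw [← add_assoc, Nat.even_add_one]
  simp only [chess, Fin.val_castSucc, Fin.val_succ, this]
  split_ifs <;> simp

theorem continuous_inv_chess (i : Fin (a + 1)) (j : Fin (b + 1)) :
    Continuous fun t : {t : ℝ // t ≠ 0} => (chess t.1 i j)⁻¹ := by
  unfold chess
  split_ifs
  · exact continuous_const
  · exact continuous_subtype_val.inv₀ fun t => t.2

/-- Opposite vertices of a face carry equal weights, so each of the two sums is merely scaled and
only κ changes. -/
theorem IsMoutard.chess_smul {M : Type*} [AddCommGroup M] [Module ℝ M] {κ : Fin a → Fin b → ℝ}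
    (hκ : ∀ i j, κ i j ≠ 0) {p : Fin (a + 1) → Fin (b + 1) → M} (hp : IsMoutard κ p) {t : ℝ}
    (ht : t ≠ 0) : ∃ κ' : Fin a → Fin b → ℝ, (∀ i j, κ' i j ≠ 0) ∧
      IsMoutard κ' fun i j => chess t i j • p i j := by
  refine ⟨fun i j => chess t i.castSucc j.castSucc * κ i j / chess t i.succ j.castSucc,
    fun i j => div_ne_zero (mul_ne_zero (chess_ne_zero ht _ _) (hκ i j)) (chess_ne_zero ht _ _),
    fun i j => ?_⟩
  have n₁ := chess_ne_zero ht i.castSucc j.castSucc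
  have n₂ := chess_ne_zero ht i.succ j.castSucc
  have h₁ := chess_horizontal t i j.castSucc
  have h₂ := chess_vertical t i.castSucc j
  have h₃ := chess_vertical t i.succ j
  have e₁ : chess t i.castSucc j.succ = chess t i.succ j.castSucc :=
    mul_left_cancel₀ n₁ (h₂.trans h₁.symm)
  have e₂ : chess t i.succ j.succ = chess t i.castSucc j.castSucc :=
    mul_left_cancel₀ n₂ (by rw [h₃, mul_comm, h₁])
  simp only [e₁, e₂]
  rw [← smul_add, hp i j]
  match_scalars <;> field_simp

/-- A function with equal values on opposite vertices of each face is a multiple of `chess`. -/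
theorem exists_eq_mul_chess (ha : 1 ≤ a) (hb : 1 ≤ b) {μ : Fin (a + 1) → Fin (b + 1) → ℝ}
    (hμ : ∀ i j, μ i j ≠ 0)
    (h₁ : ∀ (i : Fin a) (j : Fin b), μ i.castSucc j.castSucc = μ i.succ j.succ)
    (h₂ : ∀ (i : Fin a) (j : Fin b), μ i.succ j.castSucc = μ i.castSucc j.succ) :
    ∃ t : ℝ, t ≠ 0 ∧ ∀ i j, μ i j = μ 0 0 * chess t i j := by
  -- Equal values on opposite vertices make the product of the two values along every edge the same
  -- number s. Normalising the corner value to one turns s into t = s / μ 0 0 ^ 2.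
  set s := μ 0 (⟨0, hb⟩ : Fin b).castSucc * μ 0 (⟨0, hb⟩ : Fin b).succ with hs
  have hv₀ : ∀ i, μ i (⟨0, hb⟩ : Fin b).castSucc * μ i (⟨0, hb⟩ : Fin b).succ = s := by
    intro i
    induction i using Fin.induction with
    | zero => rfl
    | succ i ih => rw [← ih, ← h₁, h₂, mul_comm]
  have hh : ∀ (i : Fin a) (j : Fin (b + 1)), μ i.castSucc j * μ i.succ j = s := by
    intro i j
    induction j using Fin.induction with
    | zero =>
      have := hv₀ i.castSucc
      rw [← h₂] at this
      exact this
    | succ j ih => rw [← ih, ← h₁, h₂, mul_comm]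
  have hv : ∀ (j : Fin b) (i : Fin (a + 1)), μ i j.castSucc * μ i j.succ = s := by
    intro j
    refine forall_fin_of_castSucc_of_succ ha (fun i => ?_) (fun i => ?_)
    · rw [← h₂, hh]
    · rw [← h₁, mul_comm, hh]
  have h0 := hμ 0 0
  have ht : s / μ 0 0 ^ 2 ≠ 0 := div_ne_zero (mul_ne_zero (hμ _ _) (hμ _ _)) (pow_ne_zero 2 h0)
  refine ⟨s / μ 0 0 ^ 2, ht, fun i j => ?_⟩
  have hmul : ∀ {x y x' y' : ℝ}, x ≠ 0 → x * y = s → x' * y' = s / μ 0 0 ^ 2 →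
      x = μ 0 0 * x' → y = μ 0 0 * y' := by
    intro x y x' y' hx e e' ex
    apply mul_left_cancel₀ hx
    rw [e, ex, show μ 0 0 * x' * (μ 0 0 * y') = μ 0 0 ^ 2 * (x' * y') by ring, e']
    field_simp
  induction i using Fin.induction with
  | zero =>
    induction j using Fin.induction with
    | zero => rw [chess_zero_zero, mul_one]
    | succ j ih => exact hmul (hμ _ _) (hv j _) (chess_vertical _ _ _) ih
  | succ i ih => exact hmul (hμ _ _) (hh i _) (chess_horizontal _ _ _) ih

end chess

/-! ### Comparison of two Moutard lifts -/

section family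

variable {a b n : ℕ} {P : Net a b n} {p p' : Fin (a + 1) → Fin (b + 1) → Fin (n + 1) → ℝ}

theorem span_eq_top (hp : ∀ i j, Represents (p i j) (P i j))
    (hE : Module.finrank ℝ (⨆ i, ⨆ j, (P i j).submodule : Sub n) = n + 1) :
    Submodule.span ℝ (Set.range fun x : Fin (a + 1) × Fin (b + 1) => p x.1 x.2) = ⊤ := by
  have h : (⨆ i, ⨆ j, (P i j).submodule : Sub n) = ⊤ :=
    Submodule.eq_top_of_finrank_eq (by rw [hE, Module.finrank_fin_fun])
  rw [eq_top_iff, ← h]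
  refine iSup_le fun i => iSup_le fun j => ?_
  rw [hp i j, Submodule.span_singleton_le_iff_mem]
  exact Submodule.subset_span ⟨(i, j), rfl⟩

theorem TouchingConics.IsAdapted.smul {𝒞 : TouchingConics P} (h : 𝒞.IsAdapted p) {c : ℝ}
    (hc : c ≠ 0) : 𝒞.IsAdapted fun i j => c • p i j where
  represents i j := (h.represents i j).smul hc
  represents_S i j := by rw [← smul_sub]; exact (h.represents_S i j).smul hc
  represents_T i j := by rw [← smul_sub]; exact (h.represents_T i j).smul hc

/-- Solutions of the Moutard equation that represent the same net agree up to scaling and weights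
on the black and white vertices. -/
theorem exists_eq_chess_smul (ha : 1 ≤ a) (hb : 1 ≤ b) (hQ : IsQNet P) (hN : IsNondegenerate P)
    (hp : ∀ i j, Represents (p i j) (P i j)) (hp' : ∀ i j, Represents (p' i j) (P i j))
    {κ κ' : Fin a → Fin b → ℝ} (hm : IsMoutard κ p) (hκ' : ∀ i j, κ' i j ≠ 0)
    (hm' : IsMoutard κ' p') :
    ∃ c t : ℝ, c ≠ 0 ∧ t ≠ 0 ∧ ∀ i j, p' i j = c • chess t i j • p i j := by
  choose μ hμ hpμ using fun i j => (hp i j).exists_smul (hp' i j)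
  have key : ∀ (i : Fin a) (j : Fin b), μ i.castSucc j.castSucc = μ i.succ j.succ ∧
      μ i.succ j.castSucc = μ i.castSucc j.succ := by
    intro i j
    have hq := hN.isQuad hQ i j (hp _ _) (hp _ _) (hp _ _) (hp _ _)
    have e : p i.succ j.succ = κ i j • (p i.succ j.castSucc + p i.castSucc j.succ)
      - p i.castSucc j.castSucc := by rw [← hm i j]; abel
    have e' := hm' i j
    simp only [hpμ, e] at e'
    -- Eliminating the fourth vertex from the two Moutard equations leaves a relation between three
    -- independent vectors; its coefficients show that μ agrees on opposite vertices.
    obtain ⟨z₁, z₂, z₃⟩ := triple_independent hq.finrank_eq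
      (a := μ i.castSucc j.castSucc - μ i.succ j.succ)
      (b := μ i.succ j.succ * κ i j - κ' i j * μ i.succ j.castSucc)
      (c := μ i.succ j.succ * κ i j - κ' i j * μ i.castSucc j.succ) (by
        rw [← sub_eq_zero_of_eq e']
        module)
    refine ⟨by linarith, mul_left_cancel₀ (hκ' i j) (by linarith)⟩
  obtain ⟨t, ht, h⟩ := exists_eq_mul_chess ha hb hμ (fun i j => (key i j).1)
    (fun i j => (key i j).2)
  exact ⟨μ 0 0, t, hμ 0 0, ht, fun i j => by rw [hpμ, h, mul_smul]⟩

end family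

end KoenigsNet

/-! ### The one-parameter family -/

theorem mainTheorem1 (a b : ℕ) (ha : 1 ≤ a) (hb : 1 ≤ b)
    (P : KoenigsNet.Net a b (a + b)) (hK : KoenigsNet.IsKoenigs P)
    (hE : KoenigsNet.IsExtensive P) :
    (∀ 𝒞 : KoenigsNet.TouchingConics P,
      ∃! Q : Set (KoenigsNet.RP (a + b)), KoenigsNet.IsInscribedQuadric 𝒞 Q) ∧
    (∃ (𝒞 : {t : ℝ // t ≠ 0} → KoenigsNet.TouchingConics P)
      (φ : {t : ℝ // t ≠ 0} → KoenigsNet.Form (a + b)),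
      Function.Bijective 𝒞 ∧
      (∀ t, (φ t).IsSymm ∧ φ t ≠ 0) ∧
      (∀ x y, Continuous fun t => φ t x y) ∧
      (∀ t, KoenigsNet.IsInscribedQuadric (𝒞 t) (KoenigsNet.zeroSet (φ t))) ∧
      Set.BijOn (fun t => KoenigsNet.zeroSet (φ t)) Set.univ
        {Q | ∃ 𝒞' : KoenigsNet.TouchingConics P, KoenigsNet.IsInscribedQuadric 𝒞' Q}) := by
  open KoenigsNet in
  obtain ⟨hQ, hN, ⟨𝒞₀⟩⟩ := hK
  obtain ⟨p, hp₀⟩ := 𝒞₀.exists_isAdapted hQ hN ha hb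
  obtain ⟨κ, hκ, hm⟩ := hp₀.moutard hQ hN
  have hp := hp₀.represents
  have hs := span_eq_top hp hE.finrank_join
  have hd : Module.finrank ℝ (Fin (a + b + 1) → ℝ) = a + b + 1 := Module.finrank_fin_fun ℝ
  let q : {t : ℝ // t ≠ 0} → Fin (a + 1) → Fin (b + 1) → Fin (a + b + 1) → ℝ :=
    fun t i j => chess t.1 i j • p i j
  have hq : ∀ t i j, Represents (q t i j) (P i j) := fun t i j =>
    (hp i j).smul (chess_ne_zero t.2 i j)
  -- The inverse weights make the form equal to one on the rescaled vertices `q t`, while the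
  -- underlying basis vectors `p` stay independent of t, as continuity requires.
  let φ : {t : ℝ // t ≠ 0} → Form (a + b) := fun t =>
    crossForm hκ hm hs hd fun i j => (chess t.1 i j)⁻¹
  have hw : ∀ (t : {t : ℝ // t ≠ 0}) (i : Fin (a + 1)) (j : Fin (b + 1)),
      (chess t.1 i j)⁻¹ ≠ 0 := fun t i j => inv_ne_zero (chess_ne_zero t.2 i j)
  choose κ' hκ' hm' using fun t : {t : ℝ // t ≠ 0} => hm.chess_smul hκ t.2
  have hmi : ∀ t : {t : ℝ // t ≠ 0},
      IsMoutard (κ' t) fun i j => ((chess t.1 i j)⁻¹)⁻¹ • p i j := by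
    intro t
    simpa only [inv_inv] using hm' t
  have hrow : ∀ (t : {t : ℝ // t ≠ 0}) i i' j,
      φ t (p i j) (p i' j) = (chess t.1 i j)⁻¹ * (chess t.1 i' j)⁻¹ := fun t =>
    crossForm_row hκ hm hs hd (hw t) (hκ' t) (hmi t)
  have hφ : ∀ t, IsCrossForm (φ t) (q t) := by
    intro t
    refine ⟨isSymm_crossForm hκ hm hs hd (hw t) (hκ' t) (hmi t), fun i i' j => ?_,
      fun i j j' => ?_⟩
    · have n₁ := chess_ne_zero t.2 i j
      have n₂ := chess_ne_zero t.2 i' j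
      simp only [q, map_smul, LinearMap.smul_apply, smul_eq_mul, hrow]
      field_simp
    · have n₁ := chess_ne_zero t.2 i j
      have n₂ := chess_ne_zero t.2 i j'
      simp only [q, φ, map_smul, LinearMap.smul_apply, smul_eq_mul,
        crossForm_column hκ hm hs hd (hw t) (hκ' t) (hmi t)]
      field_simp
  choose 𝒞 h𝒞 using fun t => (hφ t).exists_isAdapted hQ hN (hq t) (hm' t)
  have hI : ∀ t, IsInscribedQuadric (𝒞 t) (zeroSet (φ t)) := fun t =>
    (h𝒞 t).isInscribedQuadric hQ hN (hφ t)
  have hU : ∀ t Q, IsInscribedQuadric (𝒞 t) Q → Q = zeroSet (φ t) := fun t Q hC =>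
    (h𝒞 t).eq_zeroSet hQ hN ha hb (hφ t) (span_eq_top (hq t) hE.finrank_join) hC
  have hsurj : Function.Surjective 𝒞 := by
    intro 𝒞'
    obtain ⟨p', hp'⟩ := 𝒞'.exists_isAdapted hQ hN ha hb
    obtain ⟨κ'', hκ'', hm''⟩ := hp'.moutard hQ hN
    obtain ⟨c, t, hc, ht, e⟩ := exists_eq_chess_smul ha hb hQ hN hp hp'.represents hm hκ'' hm''
    refine ⟨⟨t, ht⟩, (h𝒞 ⟨t, ht⟩).unique hQ hN ?_ (hφ ⟨t, ht⟩)⟩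
    -- A common factor does not affect adaptedness, so only the parameter t remains.
    have h := hp'.smul (inv_ne_zero hc)
    simpa only [e, inv_smul_smul₀ hc] using h
  have hinj : Function.Injective fun t => zeroSet (φ t) := by
    intro s t hst
    have n₁ : chess s.1 (0 : Fin (a + 1)) (0 : Fin (b + 1)) = 1 := chess_zero_zero _
    have n₂ : chess t.1 (0 : Fin (a + 1)) (0 : Fin (b + 1)) = 1 := chess_zero_zero _
    have m₁ := chess_horizontal s.1 (⟨0, ha⟩ : Fin a) (0 : Fin (b + 1))
    have m₂ := chess_horizontal t.1 (⟨0, ha⟩ : Fin a) (0 : Fin (b + 1))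
    rw [show (⟨0, ha⟩ : Fin a).castSucc = 0 from rfl] at m₁ m₂
    rw [n₁, one_mul] at m₁
    rw [n₂, one_mul] at m₂
    -- The quadric with parameter t contains the touching point p 0 0 - t p 1 0 of the first bottom
    -- edge. There the form with parameter s takes the value (1 - t / s) ^ 2, so equal quadrics
    -- force s = t.
    have hr := (h𝒞 t).represents_S ⟨0, ha⟩ 0
    rw [show (⟨0, ha⟩ : Fin a).castSucc = 0 from rfl] at hr
    have h₁ : (𝒞 t).S ⟨0, ha⟩ 0 ∈ zeroSet (φ t) := by
      rw [hr.mem_zeroSet]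
      simp [(hφ t).row]
    rw [← show zeroSet (φ s) = zeroSet (φ t) from hst, hr.mem_zeroSet] at h₁
    have hs0 := s.2
    simp only [q, n₂, m₂, one_smul, map_sub, LinearMap.sub_apply, map_smul, LinearMap.smul_apply,
      smul_eq_mul, hrow, n₁, m₁, inv_one, one_mul, mul_one] at h₁
    field_simp at h₁
    have h₂ : (s.1 - t.1) ^ 2 = 0 := by linear_combination h₁
    exact Subtype.ext (sub_eq_zero.1 (pow_eq_zero_iff two_ne_zero |>.1 h₂))
  refine ⟨fun 𝒞' => ?_, 𝒞, φ, ⟨fun s t hst => hinj (hU t _ (hst ▸ hI s)), hsurj⟩,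
    fun t => ⟨(hφ t).isSymm, (hφ t).ne_zero⟩,
    continuous_crossForm hκ hm hs hd continuous_inv_chess, hI,
    fun t _ => ⟨𝒞 t, hI t⟩, hinj.injOn, ?_⟩
  · obtain ⟨t, rfl⟩ := hsurj 𝒞'
    exact ⟨_, hI t, hU t⟩
  · rintro Q ⟨𝒞', hC⟩
    obtain ⟨t, rfl⟩ := hsurj 𝒞'
    exact ⟨t, trivial, (hU t Q hC).symm⟩
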